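/- Let $m$ be an even positive integer. An almost Hermitian manifold of dimension $m$ is a smooth $m$-manifold (Hausdorff, second countable, without boundary) with a smooth Riemannian metric $g$ and a smooth $g$-orthogonal almost complex structure $J$; its fundamental 2-form is $\Omega(X,Y)=g(JX,Y)$. It is almost Kähler if $d\Omega=0$, and Kähler if moreover $J$ is integrable, i.e. the Nijenhuis tensor $N(X,Y)=[JX,JY]-J[JX,Y]-J[X,JY]-[X,Y]$ vanishes. Let $R$ be the Riemannian curvature tensor of $g$, $R_{XYZW}=g(R(X,Y)Z,W)$. Denote by $\mathcal K$ the class of Kähler manifolds of dimension $m$, by $\mathcal{AK}_2$ the class of almost Kähler manifolds of dimension $m$ whose curvature satisfies the second Gray condition $$R_{XYZW}-R_{JX\,JY\,Z\,W}=R_{JX\,Y\,JZ\,W}+R_{JX\,Y\,Z\,JW}\quad\text{for all } X,Y,Z,W,$$ and by $\mathcal{AK}_3$ the class of almost Kähler manifolds of dimension $m$ whose curvature satisfies the third Gray condition $$R_{XYZW}=R_{JX\,JY\,JZ\,JW}\quad\text{for all } X,Y,Z,W.$$ Then in every dimension $m=2n$ with $n\ge 2$ the inclusions $\mathcal K\subset\mathcal{AK}_2\subset\mathcal{AK}_3$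 hold and are both strict. -/

import Mathlib

open scoped Manifold ContDiff

universe u

noncomputable section

/-! ### Riemannian and almost complex geometry on an open subset of a vector space

`g` is a field of bilinear forms and `J` a field of endomorphisms on a real vector space `E`; the
formulas are used only at points of an open set on which `g` is a smooth Riemannian metric and `J`
is smooth. Vectors of `E` are also regarded as constant (coordinate) vector fields. -/

namespace LocalGeometry

variable {E : Type*} [NormedAddCommGroup E] [NormedSpace ℝ E]

/-- The Christoffel symbol `Γ(v, w) = ∇_v w` of the Levi-Civita connection of `g`, for constant
vector fields `v`, `w`: the vector given by
`g(Γ(v, w), z) = (∂_v g(w, z) + ∂_w g(v, z) - ∂_z g(v, w)) / 2` for all `z`. -/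
def christoffel (g : E → E →L[ℝ] E →L[ℝ] ℝ) (x v w : E) : E :=
  (g x).inverse ((1 / 2 : ℝ) •
    (fderiv ℝ g x v w + fderiv ℝ g x w v - ((fderiv ℝ g x).flip v).flip w))

/-- The Riemannian curvature `R(u, v) w = ∇_u ∇_v w - ∇_v ∇_u w` of `g`, for constant vector
fields `u`, `v`, `w` (whose brackets vanish). -/
def curvature (g : E → E →L[ℝ] E →L[ℝ] ℝ) (x u v w : E) : E :=
  fderiv ℝ (fun y ↦ christoffel g y v w) x u - fderiv ℝ (fun y ↦ christoffel g y u w) x v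
    + christoffel g x u (christoffel g x v w) - christoffel g x v (christoffel g x u w)

/-- The Riemannian curvature as a covariant 4-tensor, `R(u, v, w, z) = g(R(u, v) w, z)`. -/
def curvatureForm (g : E → E →L[ℝ] E →L[ℝ] ℝ) (x u v w z : E) : ℝ :=
  g x (curvature g x u v w) z

/-- The fundamental 2-form `Ω(v, w) = g(J v, w)`. -/
def fundamentalForm (g : E → E →L[ℝ] E →L[ℝ] ℝ) (J : E → E →L[ℝ] E) (x v w : E) : ℝ :=
  g x (J x v) w

/-- The exterior derivative `dα(u, v, w) = ∂_u α(v, w) + ∂_v α(w, u) + ∂_w α(u, v)` of a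
2-form `α`. -/
def extDerivTwo (α : E → E → E → ℝ) (x u v w : E) : ℝ :=
  fderiv ℝ (fun y ↦ α y v w) x u + fderiv ℝ (fun y ↦ α y w u) x v
    + fderiv ℝ (fun y ↦ α y u v) x w

/-- The Nijenhuis tensor `N(X, Y) = [JX, JY] - J[JX, Y] - J[X, JY] - [X, Y]` of `J`, evaluated on
the constant vector fields `X = v` and `Y = w`. -/
def nijenhuis (J : E → E →L[ℝ] E) (x v w : E) : E :=
  VectorField.lieBracket ℝ (fun y ↦ J y v) (fun y ↦ J y w) x
    - J x (VectorField.lieBracket ℝ (fun y ↦ J y v) (fun _ ↦ w) x)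
    - J x (VectorField.lieBracket ℝ (fun _ ↦ v) (fun y ↦ J y w) x)
    - VectorField.lieBracket ℝ (fun _ ↦ v) (fun _ ↦ w) x

/-- The second Gray condition on a covariant 4-tensor `R`, with respect to `J`. -/
def GrayTwo (R : E → E → E → E → ℝ) (J : E →L[ℝ] E) : Prop :=
  ∀ X Y Z W : E, R X Y Z W - R (J X) (J Y) Z W = R (J X) Y (J Z) W + R (J X) Y Z (J W)

/-- The third Gray condition on a covariant 4-tensor `R`, with respect to `J`. -/
def GrayThree (R : E → E → E → E → ℝ) (J : E →L[ℝ] E) : Prop :=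
  ∀ X Y Z W : E, R X Y Z W = R (J X) (J Y) (J Z) (J W)

end LocalGeometry

/-- A smooth (Hausdorff, second countable) manifold of dimension `m` without boundary, with a
smooth Riemannian metric `g` and a smooth `g`-orthogonal almost complex structure `J`. -/
structure AlmostHermitianManifold (m : ℕ) where
  carrier : Type u
  [topology : TopologicalSpace carrier]
  [hausdorff : T2Space carrier]
  [secondCountable : SecondCountableTopology carrier]
  [charted : ChartedSpace (EuclideanSpace ℝ (Fin m)) carrier]
  [smooth : IsManifold (𝓡 m) ∞ carrier]
  metric : Bundle.ContMDiffRiemannianMetric (𝓡 m) ∞ (EuclideanSpace ℝ (Fin m))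
    (fun p : carrier ↦ TangentSpace (𝓡 m) p)
  J : ∀ p : carrier, TangentSpace (𝓡 m) p →L[ℝ] TangentSpace (𝓡 m) p
  J_smooth : ContMDiff (𝓡 m)
    ((𝓡 m).prod 𝓘(ℝ, EuclideanSpace ℝ (Fin m) →L[ℝ] EuclideanSpace ℝ (Fin m))) ∞
    (fun p ↦ Bundle.TotalSpace.mk'
      (E := fun p : carrier ↦ TangentSpace (𝓡 m) p →L[ℝ] TangentSpace (𝓡 m) p)
      (EuclideanSpace ℝ (Fin m) →L[ℝ] EuclideanSpace ℝ (Fin m)) p (J p))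
  J_sq : ∀ (p : carrier) (v : TangentSpace (𝓡 m) p), J p (J p v) = -v
  J_orthogonal : ∀ (p : carrier) (v w : TangentSpace (𝓡 m) p),
    metric.inner p (J p v) (J p w) = metric.inner p v w

namespace AlmostHermitianManifold

attribute [instance] topology hausdorff secondCountable charted smooth

open LocalGeometry

variable {m : ℕ} (M : AlmostHermitianManifold.{u} m)

/-- The metric in the chart `φ`, that is, its pull-back by `φ⁻¹` (meaningful on `φ.target`). -/
def chartMetric (φ : OpenPartialHomeomorph M.carrier (EuclideanSpace ℝ (Fin m)))
    (x : EuclideanSpace ℝ (Fin m)) :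
    EuclideanSpace ℝ (Fin m) →L[ℝ] EuclideanSpace ℝ (Fin m) →L[ℝ] ℝ :=
  let A : EuclideanSpace ℝ (Fin m) →L[ℝ] EuclideanSpace ℝ (Fin m) :=
    mfderiv (𝓡 m) (𝓡 m) φ.symm x
  let G : EuclideanSpace ℝ (Fin m) →L[ℝ] EuclideanSpace ℝ (Fin m) →L[ℝ] ℝ :=
    M.metric.inner (φ.symm x)
  G.bilinearComp A A

/-- The almost complex structure in the chart `φ`, that is, its pull-back by `φ⁻¹` (meaningful on
`φ.target`). -/
def chartJ (φ : OpenPartialHomeomorph M.carrier (EuclideanSpace ℝ (Fin m)))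
    (x : EuclideanSpace ℝ (Fin m)) : EuclideanSpace ℝ (Fin m) →L[ℝ] EuclideanSpace ℝ (Fin m) :=
  let A : EuclideanSpace ℝ (Fin m) →L[ℝ] TangentSpace (𝓡 m) (φ.symm x) :=
    mfderiv (𝓡 m) (𝓡 m) φ.symm x
  let B : TangentSpace (𝓡 m) (φ.symm x) →L[ℝ] EuclideanSpace ℝ (Fin m) :=
    mfderiv (𝓡 m) (𝓡 m) φ (φ.symm x)
  B.comp ((M.J (φ.symm x)).comp A)

/-- Almost Kähler: the fundamental 2-form is closed. -/
def IsAlmostKahler : Prop :=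
  ∀ φ ∈ atlas (EuclideanSpace ℝ (Fin m)) M.carrier, ∀ x ∈ φ.target,
    ∀ u v w, extDerivTwo (fundamentalForm (M.chartMetric φ) (M.chartJ φ)) x u v w = 0

/-- The almost complex structure is integrable: its Nijenhuis tensor vanishes. -/
def IsIntegrable : Prop :=
  ∀ φ ∈ atlas (EuclideanSpace ℝ (Fin m)) M.carrier, ∀ x ∈ φ.target,
    ∀ v w, nijenhuis (M.chartJ φ) x v w = 0

/-- The curvature satisfies the second Gray condition at every point. -/
def SatisfiesGrayTwo : Prop :=
  ∀ φ ∈ atlas (EuclideanSpace ℝ (Fin m)) M.carrier, ∀ x ∈ φ.target,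
    GrayTwo (curvatureForm (M.chartMetric φ) x) (M.chartJ φ x)

/-- The curvature satisfies the third Gray condition at every point. -/
def SatisfiesGrayThree : Prop :=
  ∀ φ ∈ atlas (EuclideanSpace ℝ (Fin m)) M.carrier, ∀ x ∈ φ.target,
    GrayThree (curvatureForm (M.chartMetric φ) x) (M.chartJ φ x)

end AlmostHermitianManifold

/-- The class `K` of Kähler manifolds of dimension `m`. -/
def KahlerClass (m : ℕ) : Set (AlmostHermitianManifold.{u} m) :=
  {M | M.IsAlmostKahler ∧ M.IsIntegrable}

/-- The class `AK₂` of almost Kähler manifolds of dimension `m` whose curvature satisfies the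
second Gray condition. -/
def AKTwoClass (m : ℕ) : Set (AlmostHermitianManifold.{u} m) :=
  {M | M.IsAlmostKahler ∧ M.SatisfiesGrayTwo}

/-- The class `AK₃` of almost Kähler manifolds of dimension `m` whose curvature satisfies the
third Gray condition. -/
def AKThreeClass (m : ℕ) : Set (AlmostHermitianManifold.{u} m) :=
  {M | M.IsAlmostKahler ∧ M.SatisfiesGrayThree}

end

/-!
The inclusions hold because they are local and pointwise. On a Kähler manifold `J` is parallel:
`dΩ` and the Nijenhuis tensor are two projections of `∇J` that together determine it
(`IsComplexOn.covDerivJ_eq_zero`). The curvature operators `R(X, Y)` then commute with `J`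
(`IsComplexOn.curvature_J`), which is the first Gray condition
`R(X, Y, JZ, JW) = R(X, Y, Z, W)`, and it implies the second by the symmetries of the curvature
(`IsComplexOn.grayTwo_of_grayOne`). That the second condition implies the third is linear algebra
together with the pair symmetry of the curvature (`IsMetricOn.grayThree_of_grayTwo`).

For the strictness, consider the half-plane of the points `τ = y + i x`, `x > 0`, with a conformal
metric `F(x) (dx² + dy²)`, and over each point the plane `ℝ²` with the flat metric
`x⁻¹ |dt + τ dz|² = x dz² + x⁻¹ (dt + y dz)²`. The total space has a natural complex structure, with
`dτ` and `dt + τ dz` of type `(1, 0)`. The almost complex structure `J` obtained by reversing it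
along the fibres is not integrable, while its fundamental form, the sum of an area form of the base
and of the form `dz ∧ dt`, is closed. For `F = xᵏ` everything can be computed explicitly, and it is
convenient to put `x = eˢ`, which turns the half-plane into `ℝ²`. In a suitable orthogonal frame the
curvature is a simple bilinear form in the components of `X ∧ Y` and `Z ∧ W`
(`EllipticFibration.curvatureForm_frame`), from which one reads off that the third Gray condition
always holds and the first never does, while the second holds for `k = -2` (the hyperbolic metric on
the base) and fails for `k = -1`. As the first Gray condition fails, the example with `k = -2` is
not Kähler.

In dimension `2n` one takes the product with the flat space `ℂⁿ⁻²`: its curvature is that of the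
first factor (`curvatureForm_productMetric`), so that nothing changes.
-/

noncomputable section

/-! ### Riemannian metrics and their curvature -/

namespace LocalGeometry

variable {E : Type*} [NormedAddCommGroup E] [NormedSpace ℝ E]

/-- `g` is a smooth Riemannian metric on the open set `U`. -/
structure IsMetricOn (g : E → E →L[ℝ] E →L[ℝ] ℝ) (U : Set E) : Prop where
  isOpen : IsOpen U
  contDiffOn : ContDiffOn ℝ ∞ g U
  symm : ∀ x ∈ U, ∀ v w, g x v w = g x w v
  pos : ∀ x ∈ U, ∀ v, v ≠ 0 → 0 < g x v v

/-- `J` is a smooth almost complex structure on the open set `U`, orthogonal for `g`. -/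
structure IsComplexOn (g : E → E →L[ℝ] E →L[ℝ] ℝ) (J : E → E →L[ℝ] E) (U : Set E) : Prop where
  contDiffOn : ContDiffOn ℝ ∞ J U
  sq : ∀ x ∈ U, ∀ v, J x (J x v) = -v
  orthogonal : ∀ x ∈ U, ∀ v w, g x (J x v) (J x w) = g x v w

/-- The endomorphism `Γ(v, ·)`, the connection form evaluated at `v`. As a map into `E →L[ℝ] E` it
can be differentiated before it is applied to a vector field that is not constant. -/
def christoffelMap (g : E → E →L[ℝ] E →L[ℝ] ℝ) (x v : E) : E →L[ℝ] E :=
  (g x).inverse.comp ((1 / 2 : ℝ) •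
    (fderiv ℝ g x v + (fderiv ℝ g x).flip v - ((fderiv ℝ g x).flip v).flip))

theorem christoffelMap_apply (g : E → E →L[ℝ] E →L[ℝ] ℝ) (x v w : E) :
    christoffelMap g x v w = christoffel g x v w := rfl

theorem curvature_swap (g : E → E →L[ℝ] E →L[ℝ] ℝ) (x u v w : E) :
    curvature g x v u w = -curvature g x u v w := by
  simp only [curvature]
  abel

theorem christoffel_neg_right (g : E → E →L[ℝ] E →L[ℝ] ℝ) (x v w : E) :
    christoffel g x v (-w) = -christoffel g x v w :=
  map_neg (christoffelMap g x v) w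

theorem curvature_neg_right (g : E → E →L[ℝ] E →L[ℝ] ℝ) (x u v w : E) :
    curvature g x u v (-w) = -curvature g x u v w := by
  simp only [curvature, christoffel_neg_right, fderiv_fun_neg, neg_apply]
  abel

theorem isInvertible_of_pos [FiniteDimensional ℝ E] (b : E →L[ℝ] E →L[ℝ] ℝ)
    (hb : ∀ v, v ≠ 0 → 0 < b v v) : b.IsInvertible := by
  have hinj : Function.Injective b := by
    refine (injective_iff_map_eq_zero b).2 fun v hv ↦ ?_
    by_contra h
    have := hb v h
    simp [hv] at this
  have hrank : Module.finrank ℝ E = Module.finrank ℝ (E →L[ℝ] ℝ) := by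
    rw [← (LinearMap.toContinuousLinearMap (𝕜 := ℝ) (E := E) (F' := ℝ)).finrank_eq,
      Module.finrank_linearMap, Module.finrank_self, mul_one]
  exact ⟨(LinearEquiv.ofInjectiveOfFinrankEq (b : E →ₗ[ℝ] E →L[ℝ] ℝ) hinj
    hrank).toContinuousLinearEquiv, by ext; rfl⟩

/-- The unit ball of a positive definite form is bounded: by compactness of the unit sphere, the
form is bounded below by a multiple of the norm squared. -/
theorem isVonNBounded_of_pos [FiniteDimensional ℝ E] (b : E →L[ℝ] E →L[ℝ] ℝ)
    (hb : ∀ v, v ≠ 0 → 0 < b v v) :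
    Bornology.IsVonNBounded ℝ {v : E | b v v < 1} := by
  obtain ⟨C, hC, h⟩ : ∃ C > 0, ∀ v, ‖v‖ = 1 → C ≤ b v v := by
    obtain hE | hE := (Metric.sphere (0 : E) 1).eq_empty_or_nonempty
    · exact ⟨1, one_pos, fun v hv ↦
        absurd (show v ∈ Metric.sphere (0 : E) 1 by simpa) (by simp [hE])⟩
    · have hc : Continuous fun v ↦ b v v := by fun_prop
      obtain ⟨v, hv, hmin⟩ := (isCompact_sphere (0 : E) 1).exists_isMinOn hE hc.continuousOn
      refine ⟨b v v, hb v fun h0 ↦ by simp [h0] at hv, fun w hw ↦ hmin (by simpa using hw)⟩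
  rw [NormedSpace.isVonNBounded_iff, isBounded_iff_forall_norm_le]
  refine ⟨1 / C + 1, fun v hv ↦ ?_⟩
  obtain rfl | h0 := eq_or_ne v 0
  · simp; positivity
  have hn : 0 < ‖v‖ := norm_pos_iff.2 h0
  have h1 := h (‖v‖⁻¹ • v) (by rw [norm_smul, norm_inv, norm_norm, inv_mul_cancel₀ hn.ne'])
  simp only [map_smul, smul_apply, smul_eq_mul] at h1
  have h2 : C * ‖v‖ ^ 2 ≤ b v v := by
    calc C * ‖v‖ ^ 2 ≤ (‖v‖⁻¹ * (‖v‖⁻¹ * b v v)) * ‖v‖ ^ 2 := by gcongr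
      _ = b v v := by field_simp
  have h3 : ‖v‖ ^ 2 ≤ 1 / C := by
    rw [le_div_iff₀ hC]
    linarith [show b v v < 1 from hv]
  nlinarith [sq_nonneg (‖v‖ - 1)]

namespace IsMetricOn

variable {g : E → E →L[ℝ] E →L[ℝ] ℝ} {U : Set E} (hg : IsMetricOn g U)
include hg

theorem contDiffAt {x : E} (hx : x ∈ U) : ContDiffAt ℝ ∞ g x :=
  hg.contDiffOn.contDiffAt (hg.isOpen.mem_nhds hx)

theorem isInvertible [FiniteDimensional ℝ E] {x : E} (hx : x ∈ U) : (g x).IsInvertible :=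
  isInvertible_of_pos _ (hg.pos x hx)

theorem nondegenerate {x : E} (hx : x ∈ U) {a : E} (h : ∀ z, g x a z = 0) : a = 0 := by
  by_contra ha
  exact (hg.pos x hx a ha).ne' (h a)

theorem differentiableAt {x : E} (hx : x ∈ U) : DifferentiableAt ℝ g x :=
  (hg.contDiffAt hx).differentiableAt (by simp)

theorem fderiv_symm {x : E} (hx : x ∈ U) (u v w : E) :
    fderiv ℝ g x u v w = fderiv ℝ g x u w v := by
  have h : ∀ a b : E, HasFDerivAt (fun y ↦ g y a b) (((fderiv ℝ g x).flip a).flip b) x := by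
    intro a b
    have h1 := (hg.differentiableAt hx).hasFDerivAt.clm_apply (hasFDerivAt_const a x)
    have h2 := h1.clm_apply (hasFDerivAt_const b x)
    exact h2.congr_fderiv (by ext; simp)
  have h3 : (fun y ↦ g y v w) =ᶠ[nhds x] fun y ↦ g y w v := by
    filter_upwards [hg.isOpen.mem_nhds hx] with y hy using hg.symm y hy v w
  have := ((h v w).congr_of_eventuallyEq h3.symm).unique (h w v)
  exact congrArg (fun f : E →L[ℝ] ℝ ↦ f u) this

/-- The Koszul formula. -/
theorem koszul [FiniteDimensional ℝ E] {x : E} (hx : x ∈ U) (v w z : E) :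
    g x (christoffel g x v w) z =
      (fderiv ℝ g x v w z + fderiv ℝ g x w v z - fderiv ℝ g x z v w) / 2 := by
  rw [christoffel, (hg.isInvertible hx).self_apply_inverse]
  simp
  ring

/-- The Koszul formula characterizes the Levi-Civita connection. -/
theorem christoffel_eq [FiniteDimensional ℝ E] {x : E} (hx : x ∈ U) {v w c : E}
    (h : ∀ z, g x c z =
      (fderiv ℝ g x v w z + fderiv ℝ g x w v z - fderiv ℝ g x z v w) / 2) :
    christoffel g x v w = c := by
  refine sub_eq_zero.1 (hg.nondegenerate hx fun z ↦ ?_)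
  rw [map_sub, sub_apply, hg.koszul hx, h z, sub_self]

theorem christoffel_symm [FiniteDimensional ℝ E] {x : E} (hx : x ∈ U) (v w : E) :
    christoffel g x v w = christoffel g x w v :=
  hg.christoffel_eq hx fun z ↦ by
    rw [hg.koszul hx, hg.fderiv_symm hx z v w]; ring

/-- The Levi-Civita connection is compatible with the metric. -/
theorem compatible [FiniteDimensional ℝ E] {x : E} (hx : x ∈ U) (u v w : E) :
    fderiv ℝ g x u v w =
      g x (christoffel g x u v) w + g x v (christoffel g x u w) := by
  rw [hg.symm x hx v, hg.koszul hx, hg.koszul hx, hg.fderiv_symm hx u w v]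
  ring

set_option maxSynthPendingDepth 5 in
theorem contDiffAt_christoffelMap [FiniteDimensional ℝ E] {x : E} (hx : x ∈ U) (v : E) :
    ContDiffAt ℝ ∞ (fun y ↦ christoffelMap g y v) x := by
  have h1 : ContDiffAt ℝ ∞ (fun y ↦ (g y).inverse) x :=
    ((hg.isInvertible hx).contDiffAt_map_inverse).comp x (hg.contDiffAt hx)
  have h2 : ContDiffAt ℝ ∞ (fderiv ℝ g) x := (hg.contDiffAt hx).fderiv_right (by simp)
  have h3 : ContDiffAt ℝ ∞ (fun y ↦ (fderiv ℝ g y).flip) x :=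
    (ContinuousLinearMap.flipₗᵢ ℝ E E (E →L[ℝ] ℝ)).contDiff.contDiffAt.comp x h2
  have h4 : ContDiffAt ℝ ∞ (fun y ↦ (fderiv ℝ g y).flip v) x := h3.clm_apply contDiffAt_const
  have h5 : ContDiffAt ℝ ∞ (fun y ↦ ((fderiv ℝ g y).flip v).flip) x :=
    (ContinuousLinearMap.flipₗᵢ ℝ E E ℝ).contDiff.contDiffAt.comp x h4
  exact h1.clm_comp
    (((h2.clm_apply (contDiffAt_const (c := v))).add h4).sub h5 |>.const_smul (1 / 2 : ℝ))

theorem differentiableAt_christoffelMap [FiniteDimensional ℝ E] {x : E} (hx : x ∈ U) (v : E) :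
    DifferentiableAt ℝ (fun y ↦ christoffelMap g y v) x :=
  (hg.contDiffAt_christoffelMap hx v).differentiableAt (by simp)

theorem fderiv_christoffel [FiniteDimensional ℝ E] {x : E} (hx : x ∈ U) (u v w : E) :
    fderiv ℝ (fun y ↦ christoffel g y v w) x u =
      fderiv ℝ (fun y ↦ christoffelMap g y v) x u w := by
  have h := (hg.differentiableAt_christoffelMap hx v).hasFDerivAt.clm_apply (hasFDerivAt_const w x)
  change fderiv ℝ (fun y ↦ christoffelMap g y v w) x u = _
  rw [h.fderiv]
  simp

theorem differentiableAt_christoffel [FiniteDimensional ℝ E] {x : E} (hx : x ∈ U) (v w : E) :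
    DifferentiableAt ℝ (fun y ↦ christoffel g y v w) x :=
  (hg.differentiableAt_christoffelMap hx v).clm_apply (differentiableAt_const w)

/-- The Leibniz rule for `g(a, b)`. -/
theorem fderiv_apply₂ {x : E} (hx : x ∈ U) {a b : E → E} (ha : DifferentiableAt ℝ a x)
    (hb : DifferentiableAt ℝ b x) (u : E) :
    fderiv ℝ (fun y ↦ g y (a y) (b y)) x u =
      fderiv ℝ g x u (a x) (b x) + g x (fderiv ℝ a x u) (b x) + g x (a x) (fderiv ℝ b x u) := by
  have h := ((hg.differentiableAt hx).hasFDerivAt.clm_apply ha.hasFDerivAt).clm_apply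
    hb.hasFDerivAt
  rw [h.fderiv]
  simp
  ring

theorem bianchi [FiniteDimensional ℝ E] {x : E} (hx : x ∈ U) (u v w : E) :
    curvature g x u v w + curvature g x v w u + curvature g x w u v = 0 := by
  have h : ∀ a b : E, (fun y ↦ christoffel g y a b) =ᶠ[nhds x] fun y ↦ christoffel g y b a := by
    intro a b
    filter_upwards [hg.isOpen.mem_nhds hx] with y hy using hg.christoffel_symm hy a b
  simp only [curvature]
  rw [(h v w).fderiv_eq, (h w u).fderiv_eq, (h u v).fderiv_eq,
    hg.christoffel_symm hx v w, hg.christoffel_symm hx w u, hg.christoffel_symm hx u v]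
  abel

/-- `R(u, v, w, z)` is antisymmetric in `w, z`, since the second derivatives of `g(w, z)`
commute. -/
theorem curvatureForm_antisymm [FiniteDimensional ℝ E] {x : E} (hx : x ∈ U) (u v w z : E) :
    curvatureForm g x u v w z + curvatureForm g x u v z w = 0 := by
  set f : E → ℝ := fun y ↦ g y w z with hf
  have hfd : ContDiffAt ℝ ∞ f x :=
    ((hg.contDiffAt hx).clm_apply contDiffAt_const).clm_apply contDiffAt_const
  have hsym := hfd.isSymmSndFDerivAt (by simp; norm_cast) u v
  have hff : DifferentiableAt ℝ (fderiv ℝ f) x :=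
    (hfd.fderiv_right (m := ∞) (by simp)).differentiableAt (by simp)
  -- the second derivatives of `g(w, z)`, in terms of the connection
  have key : ∀ a b : E, fderiv ℝ (fderiv ℝ f) x a b =
      g x (christoffel g x a (christoffel g x b w)) z
      + g x (christoffel g x b w) (christoffel g x a z)
      + g x (fderiv ℝ (fun y ↦ christoffel g y b w) x a) z
      + (g x (christoffel g x a w) (christoffel g x b z)
      + g x w (christoffel g x a (christoffel g x b z))
      + g x w (fderiv ℝ (fun y ↦ christoffel g y b z) x a)) := by
    intro a b
    have h1 : fderiv ℝ (fun y ↦ fderiv ℝ f y b) x a = fderiv ℝ (fderiv ℝ f) x a b := by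
      rw [(hff.hasFDerivAt.clm_apply (hasFDerivAt_const b x)).fderiv]
      simp
    have h2 : (fun y ↦ fderiv ℝ f y b) =ᶠ[nhds x]
        fun y ↦ g y (christoffel g y b w) z + g y w (christoffel g y b z) := by
      filter_upwards [hg.isOpen.mem_nhds hx] with y hy
      rw [← hg.compatible hy, hf, hg.fderiv_apply₂ hy (differentiableAt_const _)
        (differentiableAt_const _)]
      simp
    have hw := hg.differentiableAt_christoffel hx b w
    have hz := hg.differentiableAt_christoffel hx b z
    have hgd := hg.differentiableAt hx
    rw [← h1, h2.fderiv_eq, fderiv_fun_add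
      ((hgd.clm_apply hw).clm_apply (differentiableAt_const z))
      ((hgd.clm_apply (differentiableAt_const w)).clm_apply hz), add_apply,
      hg.fderiv_apply₂ hx hw (differentiableAt_const _),
      hg.fderiv_apply₂ hx (differentiableAt_const _) hz, hg.compatible hx, hg.compatible hx]
    simp
  rw [key, key] at hsym
  simp only [curvatureForm, curvature, map_add, map_sub, add_apply,
    sub_apply]
  simp only [hg.symm x hx _ w] at hsym ⊢
  linarith

/-- The pair symmetry of the curvature: it follows from the two antisymmetries and four instances of
the first Bianchi identity. -/
theorem curvatureForm_pair_symm [FiniteDimensional ℝ E] {x : E} (hx : x ∈ U) (u v w z : E) :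
    curvatureForm g x u v w z = curvatureForm g x w z u v := by
  have h12 : ∀ a b c d, curvatureForm g x b a c d = -curvatureForm g x a b c d := by
    intro a b c d
    simp [curvatureForm, curvature_swap g x a b c]
  have h34 : ∀ a b c d, curvatureForm g x a b d c = -curvatureForm g x a b c d :=
    fun a b c d ↦ by linarith [hg.curvatureForm_antisymm hx a b c d]
  have hB : ∀ a b c d, curvatureForm g x a b c d + curvatureForm g x b c a d
      + curvatureForm g x c a b d = 0 := by
    intro a b c d
    have := congrArg (fun t ↦ g x t d) (hg.bianchi hx a b c)
    simpa [curvatureForm] using this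
  have b1 := hB u v w z
  have b2 := hB v w z u
  have b3 := hB w z u v
  have b4 := hB z u v w
  simp only [h12 u w, h12 v z, h34 _ _ u z, h34 _ _ u v, h34 _ _ v w, h34 _ _ w z, h34 _ _ u w,
    h34 _ _ v z] at b1 b2 b3 b4 ⊢
  linarith

/-- The second Gray condition implies the third. The right hand side of the second condition
changes sign when `Z, W` are replaced by `J Z, J W`, so the two left hand sides add up to zero. The
sum of this identity and of the one with the pairs `X, Y` and `Z, W` exchanged is, by pair symmetry,
twice the third condition. -/
theorem grayThree_of_grayTwo [FiniteDimensional ℝ E] {x : E} (hx : x ∈ U) {J : E →L[ℝ] E}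
    (hJ : ∀ v, J (J v) = -v) (h : GrayTwo (curvatureForm g x) J) :
    GrayThree (curvatureForm g x) J := by
  have n3 : ∀ a b c d, curvatureForm g x a b (-c) d = -curvatureForm g x a b c d := fun a b c d ↦ by
    have h0 := curvature_neg_right g x a b c
    simp [curvatureForm, h0]
  have n4 : ∀ a b c d, curvatureForm g x a b c (-d) = -curvatureForm g x a b c d := fun a b c d ↦ by
    simp [curvatureForm]
  have key : ∀ X Y Z W, curvatureForm g x X Y Z W - curvatureForm g x (J X) (J Y) Z W
      + curvatureForm g x X Y (J Z) (J W) - curvatureForm g x (J X) (J Y) (J Z) (J W) = 0 := by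
    intro X Y Z W
    have h1 := h X Y Z W
    have h2 := h X Y (J Z) (J W)
    rw [hJ, hJ, n3, n4] at h2
    linarith
  intro X Y Z W
  have h1 := key X Y Z W
  have h2 := key Z W X Y
  rw [hg.curvatureForm_pair_symm hx Z W X Y, hg.curvatureForm_pair_symm hx (J Z) (J W) X Y,
    hg.curvatureForm_pair_symm hx Z W (J X) (J Y),
    hg.curvatureForm_pair_symm hx (J Z) (J W) (J X) (J Y)] at h2
  linarith

end IsMetricOn
end LocalGeometry

/-! ### Parallel complex structures and the Gray conditions -/

namespace LocalGeometry

/-- The algebra behind `∇J = 0` on a Kähler manifold, for `B(u, v, w) = g((∇_u J) v, w)`: `hcyc`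
says that `dΩ = 0` and `hN` that the Nijenhuis tensor vanishes. By `hN` the expression
`B(Ju, v, w) + B(u, v, Jw)` is symmetric in `u, v`; being antisymmetric in `v, w`, it is zero. Then
`hcyc` at `(Ju, v, w)` becomes a relation between the cyclic permutations of `B(u, v, Jw)` that
makes them vanish. -/
theorem eq_zero_of_cyclic_of_nijenhuis {T : Type*} {J : T → T} {B : T → T → T → ℝ}
    (hanti : ∀ u v w, B u v w = -B u w v) (hJ : ∀ u v w, B u (J v) w = B u v (J w))
    (hcyc : ∀ u v w, B u v w + B v w u + B w u v = 0)
    (hN : ∀ u v w, B (J u) v w - B (J v) u w + B u v (J w) - B v u (J w) = 0)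
    (hsq : ∀ u v w, B u v (J (J w)) = -B u v w) (u v w : T) : B u v w = 0 := by
  have hD : ∀ u v w, B u v (J w) = -B u w (J v) := fun u v w ↦ by rw [← hJ, hanti]
  have hT : ∀ u v w, B (J u) v w + B u v (J w) = 0 := by
    intro u v w
    linarith [hN u v w, hN v w u, hN w u v, hanti (J u) v w, hanti (J v) w u, hanti (J w) u v,
      hD u v w, hD v w u, hD w u v]
  have hzero : ∀ u v w, B u v (J w) = 0 := by
    intro u v w
    have h : ∀ a b c, -B a b (J c) + B b c (J a) + B c a (J b) = 0 := by
      intro a b c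
      have := hcyc (J a) b c
      rw [hJ c a b] at this
      linarith [hT a b c]
    linarith [h u v w, h v w u, h w u v]
  have := hsq u v w
  rw [hzero] at this
  linarith

variable {E : Type*} [NormedAddCommGroup E] [NormedSpace ℝ E]

/-- The covariant derivative `(∇_v J) w` of `J` for the Levi-Civita connection of `g`. -/
def covDerivJ (g : E → E →L[ℝ] E →L[ℝ] ℝ) (J : E → E →L[ℝ] E) (x v w : E) : E :=
  fderiv ℝ J x v w + christoffel g x v (J x w) - J x (christoffel g x v w)

/-- The first Gray condition on a covariant 4-tensor `R`, with respect to `J`. -/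
def GrayOne (R : E → E → E → E → ℝ) (J : E →L[ℝ] E) : Prop :=
  ∀ X Y Z W : E, R X Y (J Z) (J W) = R X Y Z W

namespace IsComplexOn

variable {g : E → E →L[ℝ] E →L[ℝ] ℝ} {J : E → E →L[ℝ] E} {U : Set E}

theorem differentiableAt (hg : IsMetricOn g U) (hJ : IsComplexOn g J U) {x : E} (hx : x ∈ U) :
    DifferentiableAt ℝ J x :=
  (hJ.contDiffOn.contDiffAt (hg.isOpen.mem_nhds hx)).differentiableAt (by simp)

theorem skew (hJ : IsComplexOn g J U) {x : E} (hx : x ∈ U) (v w : E) :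
    g x (J x v) w = -g x v (J x w) := by
  rw [← hJ.orthogonal x hx v, hJ.sq x hx]
  simp

theorem fderiv_apply (hg : IsMetricOn g U) (hJ : IsComplexOn g J U) {x : E} (hx : x ∈ U)
    (w u : E) : fderiv ℝ (fun y ↦ J y w) x u = fderiv ℝ J x u w := by
  rw [((hJ.differentiableAt hg hx).hasFDerivAt.clm_apply (hasFDerivAt_const w x)).fderiv]
  simp

theorem differentiableAt_apply (hg : IsMetricOn g U) (hJ : IsComplexOn g J U) {x : E}
    (hx : x ∈ U) (w : E) : DifferentiableAt ℝ (fun y ↦ J y w) x :=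
  (hJ.differentiableAt hg hx).clm_apply (differentiableAt_const w)

/-- The derivative of `J² = -1`. -/
theorem fderiv_J (hg : IsMetricOn g U) (hJ : IsComplexOn g J U) {x : E} (hx : x ∈ U) (v w : E) :
    fderiv ℝ J x v (J x w) = -J x (fderiv ℝ J x v w) := by
  have h1 := ((hJ.differentiableAt hg hx).hasFDerivAt.clm_apply
    (hJ.differentiableAt_apply hg hx w).hasFDerivAt).fderiv
  have h2 : (fun y ↦ J y (J y w)) =ᶠ[nhds x] fun _ ↦ -w := by
    filter_upwards [hg.isOpen.mem_nhds hx] with y hy using hJ.sq y hy w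
  rw [h2.fderiv_eq] at h1
  have h3 := congrArg (fun f : E →L[ℝ] E ↦ f v) h1
  simp [hJ.fderiv_apply hg hx] at h3
  rw [eq_neg_iff_add_eq_zero, add_comm]
  exact h3.symm

theorem covDerivJ_J (hg : IsMetricOn g U) (hJ : IsComplexOn g J U) {x : E} (hx : x ∈ U)
    (v w : E) : covDerivJ g J x v (J x w) = -J x (covDerivJ g J x v w) := by
  simp only [covDerivJ, hJ.fderiv_J hg hx, hJ.sq x hx, map_add, map_sub, christoffel_neg_right]
  abel

variable [FiniteDimensional ℝ E]

/-- The derivative of `Ω(v, w)`, split into the part of `∇J` and the part of the connection. -/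
theorem fderiv_fundamentalForm (hg : IsMetricOn g U) (hJ : IsComplexOn g J U) {x : E} (hx : x ∈ U)
    (u v w : E) : fderiv ℝ (fundamentalForm g J · v w) x u =
      g x (covDerivJ g J x u v) w + g x (J x (christoffel g x u v)) w
        - g x (J x (christoffel g x u w)) v := by
  have h := hg.fderiv_apply₂ hx (hJ.differentiableAt_apply hg hx v) (differentiableAt_const w) u
  simp only [hJ.fderiv_apply hg hx] at h
  change fderiv ℝ (fun y ↦ g y (J y v) w) x u = _
  rw [h, hg.compatible hx, hJ.skew hx (christoffel g x u w) v,
    hg.symm x hx (christoffel g x u w) (J x v)]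
  simp [covDerivJ]
  ring

theorem covDerivJ_antisymm (hg : IsMetricOn g U) (hJ : IsComplexOn g J U) {x : E} (hx : x ∈ U)
    (u v w : E) : g x (covDerivJ g J x u v) w = -g x (covDerivJ g J x u w) v := by
  have h : (fundamentalForm g J · v w) =ᶠ[nhds x] fun y ↦ -fundamentalForm g J y w v := by
    filter_upwards [hg.isOpen.mem_nhds hx] with y hy
    rw [fundamentalForm, fundamentalForm, hJ.skew hy, hg.symm y hy]
  have h1 := hJ.fderiv_fundamentalForm hg hx u v w
  have h2 := hJ.fderiv_fundamentalForm hg hx u w v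
  rw [h.fderiv_eq, fderiv_fun_neg, neg_apply] at h1
  linarith

/-- `dΩ` is the cyclic sum of `∇Ω`, because the connection is torsion-free. -/
theorem extDerivTwo_eq (hg : IsMetricOn g U) (hJ : IsComplexOn g J U) {x : E} (hx : x ∈ U)
    (u v w : E) : extDerivTwo (fundamentalForm g J) x u v w =
      g x (covDerivJ g J x u v) w + g x (covDerivJ g J x v w) u
        + g x (covDerivJ g J x w u) v := by
  rw [extDerivTwo, hJ.fderiv_fundamentalForm hg hx, hJ.fderiv_fundamentalForm hg hx,
    hJ.fderiv_fundamentalForm hg hx,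
    hg.christoffel_symm hx v u, hg.christoffel_symm hx w u, hg.christoffel_symm hx w v]
  ring

/-- The Nijenhuis tensor in terms of `∇J`; all other terms cancel, because the connection is
torsion-free. -/
theorem nijenhuis_eq (hg : IsMetricOn g U) (hJ : IsComplexOn g J U) {x : E} (hx : x ∈ U)
    (v w : E) : nijenhuis J x v w =
      covDerivJ g J x (J x v) w - covDerivJ g J x (J x w) v
        - J x (covDerivJ g J x v w) + J x (covDerivJ g J x w v) := by
  simp only [nijenhuis, VectorField.lieBracket, hJ.fderiv_apply hg hx, fderiv_fun_const,
    covDerivJ, map_add, map_sub, hJ.sq x hx, Pi.zero_apply, zero_apply, map_zero]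
  rw [hg.christoffel_symm hx (J x v) w, hg.christoffel_symm hx (J x w) v,
    hg.christoffel_symm hx (J x v) (J x w), hg.christoffel_symm hx v w]
  abel

/-- On a Kähler manifold the almost complex structure is parallel. -/
theorem covDerivJ_eq_zero (hg : IsMetricOn g U) (hJ : IsComplexOn g J U) {x : E} (hx : x ∈ U)
    (hΩ : ∀ u v w, extDerivTwo (fundamentalForm g J) x u v w = 0)
    (hN : ∀ v w, nijenhuis J x v w = 0) (v w : E) : covDerivJ g J x v w = 0 := by
  refine hg.nondegenerate hx fun z ↦ eq_zero_of_cyclic_of_nijenhuis (J := J x)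
    (B := fun u v w ↦ g x (covDerivJ g J x u v) w) (hJ.covDerivJ_antisymm hg hx) ?_ ?_ ?_ ?_ v w z
  · intro u v w
    simp only [hJ.covDerivJ_J hg hx, map_neg, neg_apply, hJ.skew hx, neg_neg]
  · intro u v w
    rw [← hJ.extDerivTwo_eq hg hx, hΩ]
  · intro u v w
    have h := congrArg (fun t ↦ g x t w) ((hJ.nijenhuis_eq hg hx u v).symm.trans (hN u v))
    simp [hJ.skew hx] at h
    linarith
  · intro u v w
    simp [hJ.sq x hx]

/-- If `J` is parallel on `U`, the curvature operators commute with it. -/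
theorem curvature_J (hg : IsMetricOn g U) (hJ : IsComplexOn g J U)
    (hpar : ∀ y ∈ U, ∀ v w, covDerivJ g J y v w = 0) {x : E} (hx : x ∈ U) (u v w : E) :
    curvature g x u v (J x w) = J x (curvature g x u v w) := by
  set f : E → E := fun y ↦ J y w with hf
  have hfd : ContDiffAt ℝ ∞ f x :=
    (hJ.contDiffOn.contDiffAt (hg.isOpen.mem_nhds hx)).clm_apply contDiffAt_const
  have hsym := hfd.isSymmSndFDerivAt (by simp; norm_cast) u v
  have hff : DifferentiableAt ℝ (fderiv ℝ f) x :=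
    (hfd.fderiv_right (m := ∞) (by simp)).differentiableAt (by simp)
  -- `∇J = 0` is a first order equation for `J`, which can be differentiated once more
  have hJ' : ∀ y ∈ U, ∀ a b, fderiv ℝ J y a b =
      J y (christoffel g y a b) - christoffel g y a (J y b) := by
    intro y hy a b
    have := hpar y hy a b
    rw [covDerivJ, sub_eq_zero] at this
    rw [← this, add_sub_cancel_right]
  have key : ∀ a b : E, fderiv ℝ (fderiv ℝ f) x a b =
      J x (christoffel g x a (christoffel g x b w))
      - christoffel g x a (J x (christoffel g x b w))
      + J x (fderiv ℝ (fun y ↦ christoffel g y b w) x a)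
      - (fderiv ℝ (fun y ↦ christoffelMap g y b) x a (J x w)
      + christoffel g x b (J x (christoffel g x a w) - christoffel g x a (J x w))) := by
    intro a b
    have h1 : fderiv ℝ (fun y ↦ fderiv ℝ f y b) x a = fderiv ℝ (fderiv ℝ f) x a b := by
      rw [(hff.hasFDerivAt.clm_apply (hasFDerivAt_const b x)).fderiv]
      simp
    have h2 : (fun y ↦ fderiv ℝ f y b) =ᶠ[nhds x]
        fun y ↦ J y (christoffel g y b w) - christoffelMap g y b (J y w) := by
      filter_upwards [hg.isOpen.mem_nhds hx] with y hy
      rw [hf, hJ.fderiv_apply hg hy, hJ' y hy, christoffelMap_apply]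
    have h3 := ((hJ.differentiableAt hg hx).hasFDerivAt.clm_apply
      (hg.differentiableAt_christoffel hx b w).hasFDerivAt).sub
      ((hg.differentiableAt_christoffelMap hx b).hasFDerivAt.clm_apply
      (hJ.differentiableAt_apply hg hx w).hasFDerivAt)
    have h4 := h3.fderiv
    rw [← h1, h2.fderiv_eq]
    refine (congrArg (fun l : E →L[ℝ] E ↦ l a) h4).trans ?_
    simp only [sub_apply, add_apply, ContinuousLinearMap.comp_apply,
      ContinuousLinearMap.flip_apply, hJ.fderiv_apply hg hx, hJ' x hx, christoffelMap_apply]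
    abel
  rw [key, key] at hsym
  simp only [← christoffelMap_apply, map_sub] at hsym
  rw [curvature, curvature, hg.fderiv_christoffel hx u v (J x w),
    hg.fderiv_christoffel hx v u (J x w)]
  simp only [map_add, map_sub, ← christoffelMap_apply]
  simp only [christoffelMap_apply] at hsym ⊢
  rw [← sub_eq_zero] at hsym ⊢
  rw [← neg_eq_zero, ← hsym]
  abel

/-- The curvature of a Kähler manifold satisfies the first Gray condition. -/
theorem grayOne (hg : IsMetricOn g U) (hJ : IsComplexOn g J U)
    (hΩ : ∀ x ∈ U, ∀ u v w, extDerivTwo (fundamentalForm g J) x u v w = 0)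
    (hN : ∀ x ∈ U, ∀ v w, nijenhuis J x v w = 0) {x : E} (hx : x ∈ U) :
    GrayOne (curvatureForm g x) (J x) := by
  intro X Y Z W
  rw [curvatureForm, hJ.curvature_J hg (fun y hy ↦ hJ.covDerivJ_eq_zero hg hy (hΩ y hy) (hN y hy))
    hx, hJ.orthogonal x hx, curvatureForm]

/-- The first Gray condition implies the second: on the left the two terms agree by pair symmetry,
on the right the two terms cancel. -/
theorem grayTwo_of_grayOne (hg : IsMetricOn g U) (hJ : IsComplexOn g J U) {x : E} (hx : x ∈ U)
    (h : GrayOne (curvatureForm g x) (J x)) : GrayTwo (curvatureForm g x) (J x) := by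
  intro X Y Z W
  have h1 := h Z W X Y
  rw [hg.curvatureForm_pair_symm hx, hg.curvatureForm_pair_symm hx Z W] at h1
  have h2 := h (J x X) Y Z (J x W)
  rw [hJ.sq x hx] at h2
  simp only [curvatureForm, map_neg] at h1 h2 ⊢
  linarith

end IsComplexOn
end LocalGeometry

/-! ### The metric and the almost complex structure of a manifold in a chart -/

namespace AlmostHermitianManifold

open LocalGeometry Bundle

variable {m : ℕ} (M : AlmostHermitianManifold.{u} m)
  {φ : OpenPartialHomeomorph M.carrier (EuclideanSpace ℝ (Fin m))}

theorem contMDiffOn_symm (hφ : φ ∈ atlas (EuclideanSpace ℝ (Fin m)) M.carrier) :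
    ContMDiffOn (𝓡 m) (𝓡 m) ∞ φ.symm φ.target :=
  contMDiffOn_symm_of_mem_maximalAtlas (IsManifold.subset_maximalAtlas hφ)

theorem contMDiffOn_chart (hφ : φ ∈ atlas (EuclideanSpace ℝ (Fin m)) M.carrier) :
    ContMDiffOn (𝓡 m) (𝓡 m) ∞ φ φ.source :=
  contMDiffOn_of_mem_maximalAtlas (IsManifold.subset_maximalAtlas hφ)

theorem chart_mdifferentiable (hφ : φ ∈ atlas (EuclideanSpace ℝ (Fin m)) M.carrier) :
    φ.MDifferentiable (𝓡 m) (𝓡 m) :=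
  ⟨(M.contMDiffOn_chart hφ).mdifferentiableOn (by simp),
    (M.contMDiffOn_symm hφ).mdifferentiableOn (by simp)⟩

/-- The coordinate vector fields of a chart are smooth. -/
theorem contMDiffOn_coordinateField (hφ : φ ∈ atlas (EuclideanSpace ℝ (Fin m)) M.carrier)
    (v : EuclideanSpace ℝ (Fin m)) :
    ContMDiffOn (𝓡 m) (𝓡 m).tangent ∞ (fun x ↦ TotalSpace.mk' (EuclideanSpace ℝ (Fin m))
      (E := fun p : M.carrier ↦ TangentSpace (𝓡 m) p) (φ.symm x)
      (mfderiv (𝓡 m) (𝓡 m) φ.symm x v)) φ.target := by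
  have h1 := (M.contMDiffOn_symm hφ).contMDiffOn_tangentMapWithin (m := ∞) (by simp)
    φ.open_target.uniqueMDiffOn
  have h2 : ContMDiffOn (𝓡 m) (𝓡 m).tangent ∞
      (fun x ↦ (⟨x, v⟩ : TangentBundle (𝓡 m) (EuclideanSpace ℝ (Fin m)))) φ.target :=
    contMDiffOn_vectorSpace_iff_contDiffOn.2 contDiffOn_const
  refine (h1.comp h2 fun x hx ↦ hx).congr fun x hx ↦ ?_
  simp only [Function.comp, tangentMapWithin, mfderivWithin_of_isOpen φ.open_target hx]

theorem contDiffOn_chartMetric (hφ : φ ∈ atlas (EuclideanSpace ℝ (Fin m)) M.carrier) :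
    ContDiffOn ℝ ∞ (M.chartMetric φ) φ.target := by
  refine contDiffOn_clm_apply.2 fun v ↦ contDiffOn_clm_apply.2 fun w ↦ ?_
  rw [← contMDiffOn_iff_contDiffOn]
  intro x hx
  have h : ContMDiffWithinAt (𝓡 m) ((𝓡 m).prod 𝓘(ℝ)) ∞
      (fun y ↦ TotalSpace.mk' ℝ (E := Bundle.Trivial M.carrier ℝ) (φ.symm y)
        (M.metric.inner (φ.symm y) (mfderiv (𝓡 m) (𝓡 m) φ.symm y v)
          (mfderiv (𝓡 m) (𝓡 m) φ.symm y w))) φ.target x := by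
    apply ContMDiffWithinAt.clm_bundle_apply₂ (F₁ := EuclideanSpace ℝ (Fin m))
      (F₂ := EuclideanSpace ℝ (Fin m))
    · exact M.metric.contMDiff.contMDiffAt.comp_contMDiffWithinAt x (M.contMDiffOn_symm hφ x hx)
    · exact M.contMDiffOn_coordinateField hφ v x hx
    · exact M.contMDiffOn_coordinateField hφ w x hx
  simp only [contMDiffWithinAt_totalSpace] at h
  exact h.2

theorem contDiffOn_chartJ (hφ : φ ∈ atlas (EuclideanSpace ℝ (Fin m)) M.carrier) :
    ContDiffOn ℝ ∞ (M.chartJ φ) φ.target := by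
  refine contDiffOn_clm_apply.2 fun v ↦ ?_
  refine (contMDiffOn_vectorSpace_iff_contDiffOn (V := fun x ↦ M.chartJ φ x v)).1 ?_
  have h1 : ContMDiffOn (𝓡 m) (𝓡 m).tangent ∞
      (fun x ↦ TotalSpace.mk' (EuclideanSpace ℝ (Fin m))
        (E := fun p : M.carrier ↦ TangentSpace (𝓡 m) p) (φ.symm x)
        (M.J (φ.symm x) (mfderiv (𝓡 m) (𝓡 m) φ.symm x v))) φ.target := by
    apply ContMDiffOn.clm_bundle_apply (F₁ := EuclideanSpace ℝ (Fin m))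
    · exact M.J_smooth.comp_contMDiffOn (M.contMDiffOn_symm hφ)
    · exact M.contMDiffOn_coordinateField hφ v
  have h2 := (M.contMDiffOn_chart hφ).contMDiffOn_tangentMapWithin (m := ∞) (by simp)
    φ.open_source.uniqueMDiffOn
  refine (h2.comp h1 fun x hx ↦ φ.map_target hx).congr fun x hx ↦ ?_
  simp only [Function.comp, tangentMapWithin,
    mfderivWithin_of_isOpen φ.open_source (φ.map_target hx)]
  exact congrArg (fun y ↦ (⟨y, M.chartJ φ x v⟩ : TangentBundle (𝓡 m) (EuclideanSpace ℝ (Fin m))))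
    (φ.right_inv hx).symm

theorem mfderiv_symm_mfderiv (hφ : φ ∈ atlas (EuclideanSpace ℝ (Fin m)) M.carrier)
    {x : EuclideanSpace ℝ (Fin m)} (hx : x ∈ φ.target) (v : TangentSpace (𝓡 m) (φ.symm x)) :
    mfderiv (𝓡 m) (𝓡 m) φ.symm x
      (mfderiv (𝓡 m) (𝓡 m) φ (φ.symm x) v : EuclideanSpace ℝ (Fin m)) = v := by
  have h := (M.chart_mdifferentiable hφ).symm_comp_deriv (φ.map_target hx)
  rw [φ.right_inv hx] at h
  exact congrArg (fun f : TangentSpace (𝓡 m) (φ.symm x) →L[ℝ] TangentSpace (𝓡 m) (φ.symm x) ↦ f v) h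

theorem mfderiv_mfderiv_symm (hφ : φ ∈ atlas (EuclideanSpace ℝ (Fin m)) M.carrier)
    {x : EuclideanSpace ℝ (Fin m)} (hx : x ∈ φ.target) (v : EuclideanSpace ℝ (Fin m)) :
    mfderiv (𝓡 m) (𝓡 m) φ (φ.symm x) (mfderiv (𝓡 m) (𝓡 m) φ.symm x v) = v :=
  congrArg (fun f : EuclideanSpace ℝ (Fin m) →L[ℝ] EuclideanSpace ℝ (Fin m) ↦ f v)
    ((M.chart_mdifferentiable hφ).comp_symm_deriv hx)

theorem chartMetric_apply (x v w : EuclideanSpace ℝ (Fin m)) :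
    M.chartMetric φ x v w = M.metric.inner (φ.symm x) (mfderiv (𝓡 m) (𝓡 m) φ.symm x v)
      (mfderiv (𝓡 m) (𝓡 m) φ.symm x w) := rfl

theorem chartJ_apply (x v : EuclideanSpace ℝ (Fin m)) :
    M.chartJ φ x v = mfderiv (𝓡 m) (𝓡 m) φ (φ.symm x)
      (M.J (φ.symm x) (mfderiv (𝓡 m) (𝓡 m) φ.symm x v)) := rfl

theorem mfderiv_chartJ (hφ : φ ∈ atlas (EuclideanSpace ℝ (Fin m)) M.carrier)
    {x : EuclideanSpace ℝ (Fin m)} (hx : x ∈ φ.target) (v : EuclideanSpace ℝ (Fin m)) :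
    mfderiv (𝓡 m) (𝓡 m) φ.symm x (M.chartJ φ x v) =
      M.J (φ.symm x) (mfderiv (𝓡 m) (𝓡 m) φ.symm x v) := by
  rw [chartJ_apply]
  exact M.mfderiv_symm_mfderiv hφ hx _

/-- The metric of a manifold, read in a chart of the atlas, is a metric on the target. -/
theorem isMetricOn (hφ : φ ∈ atlas (EuclideanSpace ℝ (Fin m)) M.carrier) :
    IsMetricOn (M.chartMetric φ) φ.target where
  isOpen := φ.open_target
  contDiffOn := M.contDiffOn_chartMetric hφ
  symm x _ v w := by
    rw [M.chartMetric_apply, M.chartMetric_apply, M.metric.symm]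
  pos x hx v hv := by
    rw [M.chartMetric_apply]
    refine M.metric.pos (φ.symm x) _ fun h ↦ hv ?_
    exact (M.mfderiv_mfderiv_symm hφ hx v).symm.trans
      ((congrArg (mfderiv (𝓡 m) (𝓡 m) φ (φ.symm x)) h).trans (map_zero _))

/-- The almost complex structure of a manifold, read in a chart of the atlas. -/
theorem isComplexOn (hφ : φ ∈ atlas (EuclideanSpace ℝ (Fin m)) M.carrier) :
    IsComplexOn (M.chartMetric φ) (M.chartJ φ) φ.target where
  contDiffOn := M.contDiffOn_chartJ hφ
  sq x hx v := by
    rw [M.chartJ_apply, M.mfderiv_chartJ hφ hx, M.J_sq, map_neg]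
    exact congrArg Neg.neg (M.mfderiv_mfderiv_symm hφ hx v)
  orthogonal x hx v w := by
    rw [M.chartMetric_apply, M.mfderiv_chartJ hφ hx, M.mfderiv_chartJ hφ hx, M.J_orthogonal]
    rfl

theorem grayOne_of_isKahler (hK : M.IsAlmostKahler) (hN : M.IsIntegrable)
    (hφ : φ ∈ atlas (EuclideanSpace ℝ (Fin m)) M.carrier) {x : EuclideanSpace ℝ (Fin m)}
    (hx : x ∈ φ.target) : GrayOne (curvatureForm (M.chartMetric φ) x) (M.chartJ φ x) :=
  (M.isComplexOn hφ).grayOne (M.isMetricOn hφ) (hK φ hφ) (hN φ hφ) hx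

end AlmostHermitianManifold

open AlmostHermitianManifold

theorem kahlerClass_subset_akTwoClass (m : ℕ) : KahlerClass.{u} m ⊆ AKTwoClass.{u} m :=
  fun M ⟨hK, hN⟩ ↦ ⟨hK, fun _ hφ _ hx ↦ (M.isComplexOn hφ).grayTwo_of_grayOne (M.isMetricOn hφ) hx
    (M.grayOne_of_isKahler hK hN hφ hx)⟩

theorem akTwoClass_subset_akThreeClass (m : ℕ) : AKTwoClass.{u} m ⊆ AKThreeClass.{u} m :=
  fun M ⟨hK, h2⟩ ↦ ⟨hK, fun φ hφ x hx ↦ (M.isMetricOn hφ).grayThree_of_grayTwo hx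
    ((M.isComplexOn hφ).sq x hx) (h2 φ hφ x hx)⟩

/-! ### Almost Hermitian manifolds with a global chart -/

open LocalGeometry Bundle

/-- Euclidean space `ℝᵐ` as a type of an arbitrary universe, made into a manifold by a single
chart. -/
def GlobalChart (m : ℕ) : Type u := ULift.{u} (EuclideanSpace ℝ (Fin m))

namespace GlobalChart

variable {m : ℕ}

instance : TopologicalSpace (GlobalChart.{u} m) :=
  inferInstanceAs (TopologicalSpace (ULift.{u} (EuclideanSpace ℝ (Fin m))))

/-- The global coordinates. -/
def coord (m : ℕ) : GlobalChart.{u} m ≃ₜ EuclideanSpace ℝ (Fin m) := Homeomorph.ulift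

/-- The global coordinates as a chart. -/
def chart (m : ℕ) : OpenPartialHomeomorph (GlobalChart.{u} m) (EuclideanSpace ℝ (Fin m)) :=
  (coord m).toOpenPartialHomeomorph

instance : T2Space (GlobalChart.{u} m) := (coord m).symm.t2Space

instance : SecondCountableTopology (GlobalChart.{u} m) := (coord m).secondCountableTopology

instance : ChartedSpace (EuclideanSpace ℝ (Fin m)) (GlobalChart.{u} m) :=
  (chart m).singletonChartedSpace rfl

instance : IsManifold (𝓡 m) ∞ (GlobalChart.{u} m) where
  compatible := ((chart m).singleton_hasGroupoid rfl _).compatible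

theorem eq_chart_of_mem_atlas {φ : OpenPartialHomeomorph (GlobalChart.{u} m)
    (EuclideanSpace ℝ (Fin m))} (hφ : φ ∈ atlas (EuclideanSpace ℝ (Fin m)) (GlobalChart.{u} m)) :
    φ = chart m := hφ

theorem chart_mem_atlas : chart m ∈ atlas (EuclideanSpace ℝ (Fin m)) (GlobalChart.{u} m) :=
  rfl

/-- As there is only one chart, the tangent bundle is trivialized by it: all the coordinate changes,
and with them the derivatives of the chart, are the identity of `ℝᵐ`. -/
theorem tangentCoordChange_eq (p q r : GlobalChart.{u} m) :
    tangentCoordChange (𝓡 m) p q r = ContinuousLinearMap.id ℝ (EuclideanSpace ℝ (Fin m)) := by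
  ext1 v
  exact tangentCoordChange_self (I := 𝓡 m) (x := p) (z := r) (v := v) (by simp; trivial)

theorem mfderiv_chart (p : GlobalChart.{u} m) :
    mfderiv (𝓡 m) (𝓡 m) (chart m) p = ContinuousLinearMap.id ℝ (EuclideanSpace ℝ (Fin m)) :=
  (mfderiv_chartAt_eq_tangentCoordChange (x := p) (y := p) (by trivial)).trans
    (tangentCoordChange_eq p p p)

theorem mfderiv_chart_symm (x : EuclideanSpace ℝ (Fin m)) :
    mfderiv (𝓡 m) (𝓡 m) (chart.{u} m).symm x =
      ContinuousLinearMap.id ℝ (EuclideanSpace ℝ (Fin m)) := by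
  have h : (chart.{u} m).MDifferentiable (𝓡 m) (𝓡 m) := mdifferentiable_of_mem_atlas chart_mem_atlas
  have h1 := h.comp_symm_deriv (x := x) (by trivial)
  rw [mfderiv_chart] at h1
  exact h1

theorem continuousLinearMapAt_eq (p q : GlobalChart.{u} m) :
    (trivializationAt (EuclideanSpace ℝ (Fin m)) (TangentSpace (𝓡 m)) p).continuousLinearMapAt ℝ q
      = ContinuousLinearMap.id ℝ (EuclideanSpace ℝ (Fin m)) := by
  rw [TangentBundle.continuousLinearMapAt_trivializationAt_eq_core (by trivial)]
  exact tangentCoordChange_eq _ _ _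

theorem symmL_eq (p q : GlobalChart.{u} m) :
    (trivializationAt (EuclideanSpace ℝ (Fin m)) (TangentSpace (𝓡 m)) p).symmL ℝ q
      = ContinuousLinearMap.id ℝ (EuclideanSpace ℝ (Fin m)) := by
  rw [TangentBundle.symmL_trivializationAt_eq_core (by trivial)]
  exact tangentCoordChange_eq _ _ _


theorem symm_eq (p q : GlobalChart.{u} m) (v : EuclideanSpace ℝ (Fin m)) :
    (trivializationAt (EuclideanSpace ℝ (Fin m)) (TangentSpace (𝓡 m)) p).symm q v = v := by
  rw [← Trivialization.symmL_apply (R := ℝ) _ (by trivial), symmL_eq]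
  rfl

theorem contMDiff_endomorphism {J : EuclideanSpace ℝ (Fin m) →
    EuclideanSpace ℝ (Fin m) →L[ℝ] EuclideanSpace ℝ (Fin m)} (hJ : ContDiff ℝ ∞ J) :
    ContMDiff (𝓡 m)
    ((𝓡 m).prod 𝓘(ℝ, EuclideanSpace ℝ (Fin m) →L[ℝ] EuclideanSpace ℝ (Fin m))) ∞
    (fun p ↦ Bundle.TotalSpace.mk'
      (E := fun p : GlobalChart.{u} m ↦ TangentSpace (𝓡 m) p →L[ℝ] TangentSpace (𝓡 m) p)
      (EuclideanSpace ℝ (Fin m) →L[ℝ] EuclideanSpace ℝ (Fin m)) p (J (coord m p))) := by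
  intro p
  rw [contMDiffAt_hom_bundle]
  refine ⟨contMDiffAt_id, ?_⟩
  have h : ContMDiffAt (𝓡 m) 𝓘(ℝ, EuclideanSpace ℝ (Fin m) →L[ℝ] EuclideanSpace ℝ (Fin m)) ∞
      (fun q ↦ J (chart m q)) p := hJ.contMDiff.contMDiffAt.comp p
    (contMDiffAt_of_mem_maximalAtlas (IsManifold.subset_maximalAtlas chart_mem_atlas) (by trivial))
  refine h.congr_of_eventuallyEq (Filter.Eventually.of_forall fun q ↦ ?_)
  ext1 v
  simp only [ContinuousLinearMap.inCoordinates, continuousLinearMapAt_eq, symmL_eq]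
  rfl

theorem contMDiff_metric {g : EuclideanSpace ℝ (Fin m) →
    EuclideanSpace ℝ (Fin m) →L[ℝ] EuclideanSpace ℝ (Fin m) →L[ℝ] ℝ} (hg : ContDiff ℝ ∞ g) :
    ContMDiff (𝓡 m)
    ((𝓡 m).prod 𝓘(ℝ, EuclideanSpace ℝ (Fin m) →L[ℝ] EuclideanSpace ℝ (Fin m) →L[ℝ] ℝ)) ∞
    (fun p ↦ Bundle.TotalSpace.mk'
      (E := fun p : GlobalChart.{u} m ↦ TangentSpace (𝓡 m) p →L[ℝ] TangentSpace (𝓡 m) p →L[ℝ] ℝ)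
      (EuclideanSpace ℝ (Fin m) →L[ℝ] EuclideanSpace ℝ (Fin m) →L[ℝ] ℝ) p (g (coord m p))) := by
  intro p
  rw [contMDiffAt_hom_bundle]
  refine ⟨contMDiffAt_id, ?_⟩
  have h : ContMDiffAt (𝓡 m)
      𝓘(ℝ, EuclideanSpace ℝ (Fin m) →L[ℝ] EuclideanSpace ℝ (Fin m) →L[ℝ] ℝ) ∞
      (fun q ↦ g (chart m q)) p := hg.contMDiff.contMDiffAt.comp p
    (contMDiffAt_of_mem_maximalAtlas (IsManifold.subset_maximalAtlas chart_mem_atlas) (by trivial))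
  refine h.congr_of_eventuallyEq (Filter.Eventually.of_forall fun q ↦ ?_)
  ext v w
  rw [inCoordinates_apply_eq₂ (by trivial) (by trivial) (by trivial)]
  simp [symm_eq]
  rfl

variable {g : EuclideanSpace ℝ (Fin m) →
    EuclideanSpace ℝ (Fin m) →L[ℝ] EuclideanSpace ℝ (Fin m) →L[ℝ] ℝ}
  {J : EuclideanSpace ℝ (Fin m) → EuclideanSpace ℝ (Fin m) →L[ℝ] EuclideanSpace ℝ (Fin m)}

/-- The almost Hermitian manifold `(ℝᵐ, g, J)`, with a single chart. -/
def almostHermitian (hg : IsMetricOn g Set.univ) (hJ : IsComplexOn g J Set.univ) :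
    AlmostHermitianManifold.{u} m where
  carrier := GlobalChart.{u} m
  metric :=
    { inner := fun p ↦ g (coord m p)
      symm := fun p ↦ hg.symm (coord m p) trivial
      pos := fun p ↦ hg.pos (coord m p) trivial
      isVonNBounded := fun p ↦ isVonNBounded_of_pos (g (coord m p)) (hg.pos (coord m p) trivial)
      contMDiff := contMDiff_metric (contDiffOn_univ.1 hg.contDiffOn) }
  J := fun p ↦ J (coord m p)
  J_smooth := contMDiff_endomorphism (contDiffOn_univ.1 hJ.contDiffOn)
  J_sq := fun p ↦ hJ.sq (coord m p) trivial
  J_orthogonal := fun p ↦ hJ.orthogonal (coord m p) trivial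

variable (hg : IsMetricOn g Set.univ) (hJ : IsComplexOn g J Set.univ)

theorem chartMetric_eq : (almostHermitian.{u} hg hJ).chartMetric (chart m) = g := by
  ext x v w
  change g (coord m ((chart m).symm x)) (mfderiv (𝓡 m) (𝓡 m) (chart.{u} m).symm x v)
    (mfderiv (𝓡 m) (𝓡 m) (chart.{u} m).symm x w) = _
  rw [mfderiv_chart_symm]
  rfl

theorem chartJ_eq : (almostHermitian.{u} hg hJ).chartJ (chart m) = J := by
  ext1 x
  ext1 v
  change mfderiv (𝓡 m) (𝓡 m) (chart.{u} m) ((chart m).symm x)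
    (J (coord m ((chart m).symm x)) (mfderiv (𝓡 m) (𝓡 m) (chart.{u} m).symm x v)) = _
  rw [mfderiv_chart_symm, mfderiv_chart]
  rfl

theorem isAlmostKahler_iff : (almostHermitian.{u} hg hJ).IsAlmostKahler ↔
    ∀ x u v w, extDerivTwo (fundamentalForm g J) x u v w = 0 := by
  constructor
  · intro h
    simpa only [chartMetric_eq, chartJ_eq] using fun x ↦ h (chart m) chart_mem_atlas x trivial
  · intro h φ hφ x _
    obtain rfl := eq_chart_of_mem_atlas hφ
    simpa only [chartMetric_eq, chartJ_eq] using h x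

theorem satisfiesGrayTwo_iff : (almostHermitian.{u} hg hJ).SatisfiesGrayTwo ↔
    ∀ x, GrayTwo (curvatureForm g x) (J x) := by
  constructor
  · intro h
    simpa only [chartMetric_eq, chartJ_eq] using fun x ↦ h (chart m) chart_mem_atlas x trivial
  · intro h φ hφ x _
    obtain rfl := eq_chart_of_mem_atlas hφ
    simpa only [chartMetric_eq, chartJ_eq] using h x

theorem satisfiesGrayThree_iff : (almostHermitian.{u} hg hJ).SatisfiesGrayThree ↔
    ∀ x, GrayThree (curvatureForm g x) (J x) := by
  constructor
  · intro h
    simpa only [chartMetric_eq, chartJ_eq] using fun x ↦ h (chart m) chart_mem_atlas x trivial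
  · intro h φ hφ x _
    obtain rfl := eq_chart_of_mem_atlas hφ
    simpa only [chartMetric_eq, chartJ_eq] using h x

theorem grayOne_of_mem_kahlerClass (h : almostHermitian.{u} hg hJ ∈ KahlerClass m)
    (x : EuclideanSpace ℝ (Fin m)) : GrayOne (curvatureForm g x) (J x) := by
  simpa only [chartMetric_eq, chartJ_eq] using
    (almostHermitian.{u} hg hJ).grayOne_of_isKahler h.1 h.2 chart_mem_atlas (x := x) trivial

end GlobalChart

/-! ### Products with a flat factor -/

namespace LocalGeometry

open scoped RealInnerProductSpace

variable {E V F : Type*} [NormedAddCommGroup E] [NormedSpace ℝ E]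
  [NormedAddCommGroup V] [NormedSpace ℝ V] [NormedAddCommGroup F] [InnerProductSpace ℝ F]

/-- The product of the metric `h` on `V` and the flat metric of `F`, transported to `E` along the
linear isomorphism `L`. -/
def productMetric (L : E ≃L[ℝ] V × F) (h : V → V →L[ℝ] V →L[ℝ] ℝ) (x : E) :
    E →L[ℝ] E →L[ℝ] ℝ :=
  let b : F →L[ℝ] F →L[ℝ] ℝ := innerSL ℝ
  (h (L x).1).bilinearComp (.fst ℝ V F ∘L L) (.fst ℝ V F ∘L L)
    + b.bilinearComp (.snd ℝ V F ∘L L) (.snd ℝ V F ∘L L)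

/-- The product of the almost complex structure `j` on `V` and the constant one `K` on `F`,
transported to `E` along the linear isomorphism `L`. -/
def productJ (L : E ≃L[ℝ] V × F) (j : V → V →L[ℝ] V) (K : F →L[ℝ] F) (x : E) : E →L[ℝ] E :=
  L.symm ∘L ((j (L x).1).prodMap K ∘L L)

variable (L : E ≃L[ℝ] V × F) {h : V → V →L[ℝ] V →L[ℝ] ℝ} {j : V → V →L[ℝ] V}
  {K : F →L[ℝ] F}

theorem productMetric_apply (x v w : E) :
    productMetric L h x v w = h (L x).1 (L v).1 (L w).1 + ⟪(L v).2, (L w).2⟫ := by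
  simp [productMetric]
  rfl

theorem productJ_apply (x v : E) : L (productJ L j K x v) = (j (L x).1 (L v).1, K (L v).2) := by
  simp [productJ]
  rfl

theorem productMetric_isMetricOn [FiniteDimensional ℝ E] [FiniteDimensional ℝ V]
    (hh : IsMetricOn h Set.univ) : IsMetricOn (productMetric L h) Set.univ where
  isOpen := isOpen_univ
  contDiffOn := by
    have h1 := contDiffOn_univ.1 hh.contDiffOn
    have h2 : ContDiff ℝ ∞ fun x ↦ h (L x).1 := h1.comp (contDiff_fst.comp L.contDiff)
    refine contDiffOn_univ.2 (contDiff_clm_apply_iff.2 fun v ↦ contDiff_clm_apply_iff.2 fun w ↦ ?_)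
    simp only [productMetric_apply]
    exact ((h2.clm_apply contDiff_const).clm_apply contDiff_const).add contDiff_const
  symm x _ v w := by
    simp only [productMetric_apply]
    rw [hh.symm _ trivial, real_inner_comm]
  pos x _ v hv := by
    rw [productMetric_apply]
    have hnn : 0 ≤ h (L x).1 (L v).1 (L v).1 := by
      obtain h0 | h0 := eq_or_ne (L v).1 0
      · simp [h0]
      · exact (hh.pos _ trivial _ h0).le
    obtain h1 | h1 := eq_or_ne (L v).1 0
    · have h2 : (L v).2 ≠ 0 := fun h2 ↦ hv (L.map_eq_zero_iff.1 (Prod.ext h1 h2))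
      exact add_pos_of_nonneg_of_pos hnn (real_inner_self_pos.2 h2)
    · exact add_pos_of_pos_of_nonneg (hh.pos _ trivial _ h1) real_inner_self_nonneg

theorem productJ_isComplexOn [FiniteDimensional ℝ E] (hj : IsComplexOn h j Set.univ)
    (hK : ∀ w, K (K w) = -w) (hK' : ∀ v w, ⟪K v, K w⟫ = ⟪v, w⟫) :
    IsComplexOn (productMetric L h) (productJ L j K) Set.univ where
  contDiffOn := by
    have h1 := contDiffOn_univ.1 hj.contDiffOn
    have h2 : ContDiff ℝ ∞ fun x ↦ j (L x).1 := h1.comp (contDiff_fst.comp L.contDiff)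
    refine contDiffOn_univ.2 (contDiff_clm_apply_iff.2 fun v ↦ ?_)
    exact L.symm.contDiff.comp ((h2.clm_apply contDiff_const).prodMk contDiff_const)
  sq x _ v := L.injective (by
    rw [productJ_apply, productJ_apply, hj.sq _ trivial, hK, map_neg]; rfl)
  orthogonal x _ v w := by
    simp only [productMetric_apply, productJ_apply]
    rw [hj.orthogonal _ trivial, hK']

variable [FiniteDimensional ℝ E] [FiniteDimensional ℝ V]

theorem fderiv_productMetric (hh : IsMetricOn h Set.univ) (x u v w : E) :
    fderiv ℝ (productMetric L h) x u v w = fderiv ℝ h (L x).1 (L u).1 (L v).1 (L w).1 := by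
  have h0 := productMetric_isMetricOn L hh
  have h1 := h0.fderiv_apply₂ (x := x) trivial (differentiableAt_const v)
    (differentiableAt_const w) u
  have h2 := hh.fderiv_apply₂ (x := (L x).1) trivial (differentiableAt_const (L v).1)
    (differentiableAt_const (L w).1) (L u).1
  have hd : DifferentiableAt ℝ (fun p ↦ h p (L v).1 (L w).1) (L x).1 :=
    ((hh.differentiableAt trivial).clm_apply (differentiableAt_const _)).clm_apply
      (differentiableAt_const _)
  have h3 : HasFDerivAt (fun y ↦ h (L y).1 (L v).1 (L w).1 + ⟪(L v).2, (L w).2⟫) _ x :=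
    (hd.hasFDerivAt.comp x (.fst ℝ V F ∘L L : E →L[ℝ] V).hasFDerivAt).add_const _
  simp only [fderiv_fun_const, Pi.zero_apply, zero_apply, map_zero, add_zero] at h1 h2
  simp only [productMetric_apply, h3.fderiv] at h1
  rw [← h1, ← h2]
  rfl

theorem christoffel_productMetric (hh : IsMetricOn h Set.univ) (x v w : E) :
    christoffel (productMetric L h) x v w =
      L.symm (christoffel h (L x).1 (L v).1 (L w).1, 0) := by
  refine (productMetric_isMetricOn L hh).christoffel_eq trivial fun z ↦ ?_
  simp only [productMetric_apply, fderiv_productMetric L hh, L.apply_symm_apply, inner_zero_left,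
    add_zero]
  exact hh.koszul trivial _ _ _

theorem curvature_productMetric (hh : IsMetricOn h Set.univ) (x u v w : E) :
    curvature (productMetric L h) x u v w =
      L.symm (curvature h (L x).1 (L u).1 (L v).1 (L w).1, 0) := by
  have key : ∀ u v : E, fderiv ℝ (fun y ↦ christoffel (productMetric L h) y v w) x u =
      L.symm (fderiv ℝ (fun p ↦ christoffel h p (L v).1 (L w).1) (L x).1 (L u).1, 0) := by
    intro u v
    have hd := hh.differentiableAt_christoffel (x := (L x).1) trivial (L v).1 (L w).1
    have h2 : HasFDerivAt (fun y ↦ christoffel h (L y).1 (L v).1 (L w).1) _ x :=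
      HasFDerivAt.comp (g := fun p ↦ christoffel h p (L v).1 (L w).1)
        (f := (.fst ℝ V F ∘L L : E →L[ℝ] V)) x hd.hasFDerivAt (ContinuousLinearMap.hasFDerivAt _)
    have h3 : HasFDerivAt (fun y ↦ L.symm (christoffel h (L y).1 (L v).1 (L w).1, (0 : F))) _ x :=
      (L.symm : V × F →L[ℝ] E).hasFDerivAt.comp x (h2.prodMk (hasFDerivAt_const (0 : F) x))
    simp only [christoffel_productMetric L hh]
    rw [h3.fderiv]
    rfl
  simp only [curvature]
  rw [key, key]
  simp only [christoffel_productMetric L hh, L.apply_symm_apply, ← map_sub, ← map_add,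
    Prod.mk_sub_mk, Prod.mk_add_mk, sub_zero, add_zero]

theorem curvatureForm_productMetric (hh : IsMetricOn h Set.univ) (x u v w z : E) :
    curvatureForm (productMetric L h) x u v w z =
      curvatureForm h (L x).1 (L u).1 (L v).1 (L w).1 (L z).1 := by
  simp [curvatureForm, curvature_productMetric L hh, productMetric_apply]

theorem grayOne_product_iff (hh : IsMetricOn h Set.univ) (x : E) :
    GrayOne (curvatureForm (productMetric L h) x) (productJ L j K x) ↔
      GrayOne (curvatureForm h (L x).1) (j (L x).1) := by
  simp only [GrayOne, curvatureForm_productMetric L hh, productJ_apply]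
  refine ⟨fun H X Y Z T ↦ ?_, fun H X Y Z T ↦ H _ _ _ _⟩
  simpa using H (L.symm (X, 0)) (L.symm (Y, 0)) (L.symm (Z, 0)) (L.symm (T, 0))

theorem grayTwo_product_iff (hh : IsMetricOn h Set.univ) (x : E) :
    GrayTwo (curvatureForm (productMetric L h) x) (productJ L j K x) ↔
      GrayTwo (curvatureForm h (L x).1) (j (L x).1) := by
  simp only [GrayTwo, curvatureForm_productMetric L hh, productJ_apply]
  refine ⟨fun H X Y Z T ↦ ?_, fun H X Y Z T ↦ H _ _ _ _⟩
  simpa using H (L.symm (X, 0)) (L.symm (Y, 0)) (L.symm (Z, 0)) (L.symm (T, 0))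

theorem grayThree_product (hh : IsMetricOn h Set.univ) {x : E}
    (H : GrayThree (curvatureForm h (L x).1) (j (L x).1)) :
    GrayThree (curvatureForm (productMetric L h) x) (productJ L j K x) := by
  simp only [GrayThree, curvatureForm_productMetric L hh, productJ_apply]
  exact fun X Y Z T ↦ H _ _ _ _

omit [FiniteDimensional ℝ E] [FiniteDimensional ℝ V] in
theorem extDerivTwo_product (hh : IsMetricOn h Set.univ) (hj : IsComplexOn h j Set.univ)
    (x u v w : E) :
    extDerivTwo (fundamentalForm (productMetric L h) (productJ L j K)) x u v w =
      extDerivTwo (fundamentalForm h j) (L x).1 (L u).1 (L v).1 (L w).1 := by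
  have key : ∀ u v w : E,
      fderiv ℝ (fun y ↦ fundamentalForm (productMetric L h) (productJ L j K) y v w) x u =
      fderiv ℝ (fun p ↦ fundamentalForm h j p (L v).1 (L w).1) (L x).1 (L u).1 := by
    intro u v w
    have hd : DifferentiableAt ℝ (fun p ↦ fundamentalForm h j p (L v).1 (L w).1) (L x).1 :=
      ((hh.differentiableAt trivial).clm_apply (hj.differentiableAt_apply hh trivial _)).clm_apply
        (differentiableAt_const _)
    have h3 : HasFDerivAt (fun y ↦ fundamentalForm h j (L y).1 (L v).1 (L w).1
        + ⟪K (L v).2, (L w).2⟫) _ x :=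
      (hd.hasFDerivAt.comp x (.fst ℝ V F ∘L L : E →L[ℝ] V).hasFDerivAt).add_const _
    simp only [fundamentalForm, productMetric_apply, productJ_apply] at h3 ⊢
    rw [h3.fderiv]
    rfl
  simp only [extDerivTwo, key]

end LocalGeometry

/-! ### Curvature of the elliptic fibrations over the half-plane -/

namespace EllipticFibration

open LocalGeometry Real

/-- The space `ℝ⁴` with coordinates `(s, y, z, t)`, numbered from `0` to `3`. The projection to
`(s, y)` makes it a fibration in planes over the half-plane of the points `τ = y + i eˢ`. -/
abbrev Coord : Type := Fin 4 → ℝ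

/-- The value at `v` of the 1-form `dt + y dz`. -/
def alpha (p v : Coord) : ℝ := v 3 + p 1 * v 2

/-- The metric `e^{(k+2)s} ds² + e^{ks} dy² + eˢ dz² + e^{-s} (dt + y dz)²`. With `x = eˢ` and
`τ = y + i x`, the first two terms are the conformal metric `xᵏ (dx² + dy²)` on the half-plane, and
the last two are the flat metric `x⁻¹ |dt + τ dz|²` on the fibres. -/
def metric (k : ℝ) (p : Coord) : Coord →L[ℝ] Coord →L[ℝ] ℝ :=
  let e (i : Fin 4) : Coord →L[ℝ] ℝ := .proj i
  let α : Coord →L[ℝ] ℝ := e 3 + p 1 • e 2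
  exp ((k + 2) * p 0) • (e 0).smulRight (e 0) + exp (k * p 0) • (e 1).smulRight (e 1)
    + exp (p 0) • (e 2).smulRight (e 2) + exp (-p 0) • α.smulRight α

theorem metric_apply (k : ℝ) (p v w : Coord) :
    metric k p v w = exp ((k + 2) * p 0) * (v 0 * w 0) + exp (k * p 0) * (v 1 * w 1)
      + exp (p 0) * (v 2 * w 2) + exp (-p 0) * (alpha p v * alpha p w) := by
  simp [metric, alpha]
  ring

theorem isMetricOn (k : ℝ) : IsMetricOn (metric k) Set.univ where
  isOpen := isOpen_univ
  contDiffOn := by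
    refine contDiffOn_univ.2 (contDiff_clm_apply_iff.2 fun v ↦ contDiff_clm_apply_iff.2 fun w ↦ ?_)
    simp only [metric_apply, alpha]
    fun_prop
  symm p _ v w := by
    rw [metric_apply, metric_apply]
    ring
  pos p _ v hv := by
    rw [metric_apply]
    by_contra! h
    have h0 := exp_pos ((k + 2) * p 0)
    have h1 := exp_pos (k * p 0)
    have h2 := exp_pos (p 0)
    have h3 := exp_pos (-p 0)
    have n0 := mul_nonneg h0.le (mul_self_nonneg (v 0))
    have n1 := mul_nonneg h1.le (mul_self_nonneg (v 1))
    have n2 := mul_nonneg h2.le (mul_self_nonneg (v 2))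
    have n3 := mul_nonneg h3.le (mul_self_nonneg (alpha p v))
    have z0 : v 0 = 0 := by
      have : exp ((k + 2) * p 0) * (v 0 * v 0) = 0 := by linarith
      simpa [h0.ne'] using this
    have z1 : v 1 = 0 := by
      have : exp (k * p 0) * (v 1 * v 1) = 0 := by linarith
      simpa [h1.ne'] using this
    have z2 : v 2 = 0 := by
      have : exp (p 0) * (v 2 * v 2) = 0 := by linarith
      simpa [h2.ne'] using this
    have z3 : alpha p v = 0 := by
      have : exp (-p 0) * (alpha p v * alpha p v) = 0 := by linarith
      simpa [h3.ne'] using this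
    rw [alpha, z2, mul_zero, add_zero] at z3
    exact hv (funext fun i ↦ by fin_cases i <;> assumption)

theorem fderiv_coord (i : Fin 4) (p : Coord) :
    fderiv ℝ (fun q : Coord ↦ q i) p = .proj i :=
  (hasFDerivAt_apply i p).fderiv

theorem fderiv_metric (k : ℝ) (p u v w : Coord) :
    fderiv ℝ (metric k) p u v w =
      u 0 * ((k + 2) * exp ((k + 2) * p 0) * (v 0 * w 0) + k * exp (k * p 0) * (v 1 * w 1)
        + exp (p 0) * (v 2 * w 2) - exp (-p 0) * (alpha p v * alpha p w))
      + u 1 * exp (-p 0) * (v 2 * alpha p w + alpha p v * w 2) := by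
  have h := (isMetricOn k).fderiv_apply₂ (x := p) trivial (differentiableAt_const v)
    (differentiableAt_const w) u
  simp only [fderiv_fun_const, Pi.zero_apply, zero_apply, map_zero, add_zero] at h
  rw [← h]
  simp only [metric_apply, alpha]
  simp (disch := fun_prop) only [fderiv_fun_add, fderiv_fun_mul, fderiv_exp, fderiv_fun_const,
    fderiv_fun_neg, fderiv_coord]
  simp
  ring

/-- The Levi-Civita connection `∇_v w` of the metric, for constant vector fields `v`, `w`; here `c₂`
is the component along `∂_z`. -/
def connection (k : ℝ) (p v w : Coord) : Coord :=
  let c₂ := (v 0 * w 2 + w 0 * v 2 + exp (-2 * p 0) * (v 1 * alpha p w + alpha p v * w 1)) / 2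
  ![((k + 2) * (v 0 * w 0) - k * exp (-2 * p 0) * (v 1 * w 1)
      - exp (-(k + 1) * p 0) * (v 2 * w 2)
      + exp (-2 * p 0) * exp (-(k + 1) * p 0) * (alpha p v * alpha p w)) / 2,
    (k * (v 0 * w 1 + v 1 * w 0)
      - exp (-(k + 1) * p 0) * (v 2 * alpha p w + alpha p v * w 2)) / 2,
    c₂,
    (v 1 * w 2 + v 2 * w 1 - v 0 * alpha p w - alpha p v * w 0) / 2 - p 1 * c₂]

theorem connection_zero (k : ℝ) (p v w : Coord) : connection k p v w 0 =
    ((k + 2) * (v 0 * w 0) - k * exp (-2 * p 0) * (v 1 * w 1)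
      - exp (-(k + 1) * p 0) * (v 2 * w 2)
      + exp (-2 * p 0) * exp (-(k + 1) * p 0) * (alpha p v * alpha p w)) / 2 := rfl

theorem connection_one (k : ℝ) (p v w : Coord) : connection k p v w 1 =
    (k * (v 0 * w 1 + v 1 * w 0)
      - exp (-(k + 1) * p 0) * (v 2 * alpha p w + alpha p v * w 2)) / 2 := rfl

theorem connection_two (k : ℝ) (p v w : Coord) : connection k p v w 2 =
    (v 0 * w 2 + w 0 * v 2 + exp (-2 * p 0) * (v 1 * alpha p w + alpha p v * w 1)) / 2 := rfl

theorem connection_three (k : ℝ) (p v w : Coord) : connection k p v w 3 =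
    (v 1 * w 2 + v 2 * w 1 - v 0 * alpha p w - alpha p v * w 0) / 2
      - p 1 * ((v 0 * w 2 + w 0 * v 2
        + exp (-2 * p 0) * (v 1 * alpha p w + alpha p v * w 1)) / 2) := rfl

theorem alpha_connection (k : ℝ) (p v w : Coord) : alpha p (connection k p v w) =
    (v 1 * w 2 + v 2 * w 1 - v 0 * alpha p w - alpha p v * w 0) / 2 := by
  rw [alpha, connection_two, connection_three]
  ring

/-! All the exponentials are monomials in `eˢ` and `e^{ks}`. -/

theorem exp_base (k s : ℝ) : exp ((k + 2) * s) = exp (k * s) * exp s ^ 2 := by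
  rw [← exp_nat_mul, ← exp_add]
  ring_nf

theorem exp_neg_two (s : ℝ) : exp (-2 * s) = (exp s ^ 2)⁻¹ := by
  rw [← exp_nat_mul, ← exp_neg]
  ring_nf

theorem exp_neg_succ (k s : ℝ) : exp (-(k + 1) * s) = (exp (k * s) * exp s)⁻¹ := by
  rw [← exp_add, ← exp_neg]
  ring_nf

theorem christoffel_eq (k : ℝ) (p v w : Coord) :
    christoffel (metric k) p v w = connection k p v w := by
  refine (isMetricOn k).christoffel_eq trivial fun z ↦ ?_
  simp only [fderiv_metric, metric_apply, alpha_connection, connection_zero, connection_one,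
    connection_two, exp_base, exp_neg_two, exp_neg_succ, exp_neg (p 0)]
  have hE := (exp_pos (p 0)).ne'
  have hQ := (exp_pos (k * p 0)).ne'
  generalize exp (p 0) = E at *
  generalize exp (k * p 0) = Q at *
  field_simp
  ring

theorem fderiv_connection_apply (k : ℝ) (p u v w : Coord) (i : Fin 4) :
    fderiv ℝ (fun q ↦ connection k q v w) p u i =
      fderiv ℝ (fun q ↦ connection k q v w i) p u := by
  have h : DifferentiableAt ℝ (fun q ↦ connection k q v w) p := by
    simpa only [christoffel_eq] using
      (isMetricOn k).differentiableAt_christoffel (x := p) trivial v w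
  rw [fderiv_apply h]
  rfl

theorem fderiv_connection_zero (k : ℝ) (p u v w : Coord) :
    fderiv ℝ (fun q ↦ connection k q v w) p u 0 =
      (2 * k * u 0 * exp (-2 * p 0) * (v 1 * w 1)
      + (k + 1) * u 0 * exp (-(k + 1) * p 0) * (v 2 * w 2)
      - (k + 3) * u 0 * (exp (-2 * p 0) * exp (-(k + 1) * p 0)) * (alpha p v * alpha p w)
      + u 1 * (exp (-2 * p 0) * exp (-(k + 1) * p 0))
        * (v 2 * alpha p w + alpha p v * w 2)) / 2 := by
  rw [fderiv_connection_apply]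
  simp only [connection_zero, alpha, div_eq_mul_inv]
  simp (disch := fun_prop) only [fderiv_fun_add, fderiv_fun_sub, fderiv_fun_mul, fderiv_exp,
    fderiv_fun_const, fderiv_coord]
  simp
  ring

theorem fderiv_connection_one (k : ℝ) (p u v w : Coord) :
    fderiv ℝ (fun q ↦ connection k q v w) p u 1 =
      ((k + 1) * u 0 * exp (-(k + 1) * p 0) * (v 2 * alpha p w + alpha p v * w 2)
      - 2 * u 1 * exp (-(k + 1) * p 0) * (v 2 * w 2)) / 2 := by
  rw [fderiv_connection_apply]
  simp only [connection_one, alpha, div_eq_mul_inv]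
  simp (disch := fun_prop) only [fderiv_fun_add, fderiv_fun_sub, fderiv_fun_mul, fderiv_exp,
    fderiv_fun_const, fderiv_coord]
  simp
  ring

theorem fderiv_connection_two (k : ℝ) (p u v w : Coord) :
    fderiv ℝ (fun q ↦ connection k q v w) p u 2 =
      (u 1 * exp (-2 * p 0) * (v 1 * w 2 + v 2 * w 1)
      - 2 * u 0 * exp (-2 * p 0) * (v 1 * alpha p w + alpha p v * w 1)) / 2 := by
  rw [fderiv_connection_apply]
  simp only [connection_two, alpha, div_eq_mul_inv]
  simp (disch := fun_prop) only [fderiv_fun_add, fderiv_fun_mul, fderiv_exp,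
    fderiv_fun_const, fderiv_coord]
  simp
  ring

theorem alpha_fderiv_connection (k : ℝ) (p u v w : Coord) :
    alpha p (fderiv ℝ (fun q ↦ connection k q v w) p u) =
      -(u 1 * (2 * (v 0 * w 2 + w 0 * v 2)
        + exp (-2 * p 0) * (v 1 * alpha p w + alpha p v * w 1))) / 2 := by
  rw [alpha, fderiv_connection_two, fderiv_connection_apply]
  simp only [connection_three, alpha, div_eq_mul_inv]
  simp (disch := fun_prop) only [fderiv_fun_add, fderiv_fun_sub, fderiv_fun_mul, fderiv_exp,
    fderiv_fun_const, fderiv_coord]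
  simp
  ring

/-- The tangent vector with components `a` in the orthogonal frame
`∂_s, eˢ ∂_y, ∂_z - y ∂_t, eˢ ∂_t`. -/
def frame (p a : Coord) : Coord :=
  ![a 0, exp (p 0) * a 1, a 2, exp (p 0) * a 3 - p 1 * a 2]

theorem alpha_frame (p a : Coord) : alpha p (frame p a) = exp (p 0) * a 3 := by
  simp [alpha, frame]

theorem frame_surjective (p : Coord) : Function.Surjective (frame p) := by
  intro v
  refine ⟨![v 0, exp (-p 0) * v 1, v 2, exp (-p 0) * alpha p v], funext fun i ↦ ?_⟩
  fin_cases i <;> simp [frame, alpha, ← mul_assoc, ← exp_add]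

/-- The components `a_i b_j - a_j b_i` of `a ∧ b`. -/
def wedge (a b : Coord) (i j : Fin 4) : ℝ := a i * b j - a j * b i

theorem alpha_add (p v w : Coord) : alpha p (v + w) = alpha p v + alpha p w := by
  simp [alpha]; ring

theorem alpha_sub (p v w : Coord) : alpha p (v - w) = alpha p v - alpha p w := by
  simp [alpha]; ring

/-- The curvature of the metric in the orthogonal frame. -/
theorem curvatureForm_frame (k : ℝ) (p a b c d : Coord) :
    curvatureForm (metric k) p (frame p a) (frame p b) (frame p c) (frame p d) =
      -(k / 2) * (exp (k * p 0) * exp (p 0) ^ 2) * (wedge a b 0 1 * wedge c d 0 1)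
      + exp (p 0) / 2 * (wedge a b 0 1 * wedge c d 2 3 + wedge a b 2 3 * wedge c d 0 1)
      - (k + 1) / 4 * exp (p 0)
        * ((wedge a b 0 2 + wedge a b 1 3) * (wedge c d 0 2 + wedge c d 1 3))
      + (k + 3) / 4 * exp (p 0)
        * ((wedge a b 0 3 - wedge a b 1 2) * (wedge c d 0 3 - wedge c d 1 2))
      - (exp (k * p 0))⁻¹ / 2 * (wedge a b 2 3 * wedge c d 2 3) := by
  have f0 : ∀ a, frame p a 0 = a 0 := fun _ ↦ rfl
  have f1 : ∀ a, frame p a 1 = exp (p 0) * a 1 := fun _ ↦ rfl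
  have f2 : ∀ a, frame p a 2 = a 2 := fun _ ↦ rfl
  simp only [curvatureForm, curvature, christoffel_eq, metric_apply, Pi.add_apply, Pi.sub_apply,
    alpha_add, alpha_sub, fderiv_connection_zero, fderiv_connection_one, fderiv_connection_two,
    alpha_fderiv_connection, connection_zero, connection_one, connection_two, alpha_connection,
    alpha_frame, f0, f1, f2, wedge, exp_base, exp_neg_two, exp_neg_succ, exp_neg (p 0)]
  have hE := (exp_pos (p 0)).ne'
  have hQ := (exp_pos (k * p 0)).ne'
  generalize exp (p 0) = E at *
  generalize exp (k * p 0) = Q at *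
  field_simp
  ring

/-! ### The almost complex structure of the elliptic fibrations -/

/-- The almost complex structure with `J ∂_s = -eˢ ∂_y` and `J (∂_z - y ∂_t) = eˢ ∂_t`. The opposite
sign in the first formula would give an integrable structure; with this one, it is the complex
structure of the half-plane on the base and opposite to that of `dt + τ dz` on the fibres. -/
def complexStructure (p : Coord) : Coord →L[ℝ] Coord :=
  let e (i : Fin 4) : Coord →L[ℝ] ℝ := .proj i
  let α : Coord →L[ℝ] ℝ := e 3 + p 1 • e 2
  .pi ![exp (-p 0) • e 1, -exp (p 0) • e 0, -exp (-p 0) • α,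
    exp (p 0) • e 2 + (p 1 * exp (-p 0)) • α]

theorem complexStructure_apply (p v : Coord) : complexStructure p v =
    ![exp (-p 0) * v 1, -exp (p 0) * v 0, -exp (-p 0) * alpha p v,
      exp (p 0) * v 2 + p 1 * exp (-p 0) * alpha p v] := by
  funext i
  fin_cases i <;> simp [complexStructure, alpha]
  all_goals ring

/-- The almost complex structure in the orthogonal frame. -/
def rotate (a : Coord) : Coord := ![a 1, -a 0, -a 3, a 2]

theorem complexStructure_frame (p a : Coord) :
    complexStructure p (frame p a) = frame p (rotate a) := by
  have h : exp (-p 0) * exp (p 0) = 1 := by rw [← exp_add]; simp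
  rw [complexStructure_apply, alpha_frame]
  funext i
  fin_cases i
  · simp [frame, rotate, ← mul_assoc, h]
  · simp [frame, rotate]
  · simp [frame, rotate, ← mul_assoc, h]
  · simp [frame, rotate]
    linear_combination p 1 * a 3 * h

theorem metric_frame (k : ℝ) (p a b : Coord) : metric k p (frame p a) (frame p b) =
    exp (k * p 0) * exp (p 0) ^ 2 * (a 0 * b 0 + a 1 * b 1)
      + exp (p 0) * (a 2 * b 2 + a 3 * b 3) := by
  have f0 : ∀ a, frame p a 0 = a 0 := fun _ ↦ rfl
  have f1 : ∀ a, frame p a 1 = exp (p 0) * a 1 := fun _ ↦ rfl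
  have f2 : ∀ a, frame p a 2 = a 2 := fun _ ↦ rfl
  simp only [metric_apply, alpha_frame, f0, f1, f2, exp_base, exp_neg (p 0)]
  have hE := (exp_pos (p 0)).ne'
  field_simp
  ring

theorem isComplexOn (k : ℝ) : IsComplexOn (metric k) complexStructure Set.univ where
  contDiffOn := by
    refine contDiffOn_univ.2 (contDiff_clm_apply_iff.2 fun v ↦ contDiff_pi.2 fun i ↦ ?_)
    simp only [complexStructure_apply, alpha]
    fin_cases i <;> simp <;> fun_prop
  sq p _ v := by
    obtain ⟨a, rfl⟩ := frame_surjective p v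
    rw [complexStructure_frame, complexStructure_frame]
    funext i
    fin_cases i <;> simp [frame, rotate]
    ring
  orthogonal p _ v w := by
    obtain ⟨a, rfl⟩ := frame_surjective p v
    obtain ⟨b, rfl⟩ := frame_surjective p w
    simp only [complexStructure_frame, metric_frame]
    simp [rotate]
    ring

theorem fundamentalForm_eq (k : ℝ) (p v w : Coord) :
    fundamentalForm (metric k) complexStructure p v w =
      exp ((k + 1) * p 0) * (v 1 * w 0 - v 0 * w 1) + (v 2 * w 3 - v 3 * w 2) := by
  have h : exp ((k + 1) * p 0) = exp (k * p 0) * exp (p 0) := by rw [← exp_add]; ring_nf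
  have hE := (exp_pos (p 0)).ne'
  rw [fundamentalForm, metric_apply, h, exp_base]
  simp only [complexStructure_apply, alpha, Matrix.cons_val, exp_neg (p 0)]
  field_simp
  ring

theorem extDerivTwo_fundamentalForm (k : ℝ) (p u v w : Coord) :
    extDerivTwo (fundamentalForm (metric k) complexStructure) p u v w = 0 := by
  have h : ∀ u v w : Coord, fderiv ℝ (fun q ↦ fundamentalForm (metric k) complexStructure q v w) p u
      = (k + 1) * exp ((k + 1) * p 0) * u 0 * (v 1 * w 0 - v 0 * w 1) := by
    intro u v w
    simp only [fundamentalForm_eq]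
    simp (disch := fun_prop) only [fderiv_fun_add, fderiv_fun_mul, fderiv_exp, fderiv_fun_const,
      fderiv_coord]
    simp
    ring
  rw [extDerivTwo, h, h, h]
  ring

/-- Replacing two vectors of a pair by their images under `J` fixes the components `01` and `23` of
their wedge product and changes the sign of `02 + 13` and `03 - 12`, so the curvature, which is
bilinear in these, is unchanged when all four vectors are replaced. -/
theorem grayThree (k : ℝ) (p : Coord) :
    GrayThree (curvatureForm (metric k) p) (complexStructure p) := by
  intro X Y Z T
  obtain ⟨a, rfl⟩ := frame_surjective p X
  obtain ⟨b, rfl⟩ := frame_surjective p Y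
  obtain ⟨c, rfl⟩ := frame_surjective p Z
  obtain ⟨d, rfl⟩ := frame_surjective p T
  simp only [complexStructure_frame, curvatureForm_frame, wedge, rotate, Matrix.cons_val]
  ring

/-- For `k = -2`, the metric of the half-plane is the hyperbolic one, and the second Gray condition
holds. -/
theorem grayTwo (p : Coord) :
    GrayTwo (curvatureForm (metric (-2)) p) (complexStructure p) := by
  intro X Y Z T
  obtain ⟨a, rfl⟩ := frame_surjective p X
  obtain ⟨b, rfl⟩ := frame_surjective p Y
  obtain ⟨c, rfl⟩ := frame_surjective p Z
  obtain ⟨d, rfl⟩ := frame_surjective p T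
  simp only [complexStructure_frame, curvatureForm_frame, wedge, rotate, Matrix.cons_val]
  ring

theorem not_grayOne : ¬ GrayOne (curvatureForm (metric (-2)) 0) (complexStructure 0) := by
  intro h
  -- a plane on which `02 + 13` does not vanish
  have := h (frame 0 ![1, 0, 0, 0]) (frame 0 ![0, 0, 1, 0]) (frame 0 ![1, 0, 0, 0])
    (frame 0 ![0, 0, 1, 0])
  simp only [complexStructure_frame, curvatureForm_frame, wedge, rotate, Matrix.cons_val] at this
  norm_num at this

theorem not_grayTwo : ¬ GrayTwo (curvatureForm (metric (-1)) 0) (complexStructure 0) := by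
  intro h
  -- for `k = -1`, only the coefficient of `03 - 12` is non-zero among the two that occur here
  have := h (frame 0 ![1, 0, 0, 0]) (frame 0 ![0, 0, 0, 1]) (frame 0 ![1, 0, 0, 0])
    (frame 0 ![0, 0, 0, 1])
  simp only [complexStructure_frame, curvatureForm_frame, wedge, rotate, Matrix.cons_val] at this
  norm_num at this

end EllipticFibration

/-! ### The examples in all even dimensions -/

open LocalGeometry EllipticFibration

/-- Linear coordinates on `ℝ²ⁿ` that split it as `ℝ⁴ × ℂⁿ⁻²`; any choice will do. -/
def splitting (n : ℕ) (hn : 2 ≤ n) :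
    EuclideanSpace ℝ (Fin (2 * n)) ≃L[ℝ] Coord × EuclideanSpace ℂ (Fin (n - 2)) :=
  .ofFinrankEq (by
    rw [Module.finrank_prod, finrank_euclideanSpace_fin, finrank_real_of_complex,
      finrank_euclideanSpace_fin, Module.finrank_fin_fun]
    omega)

/-- Multiplication by `i` on `ℂᵏ`. -/
def mulI (k : ℕ) : EuclideanSpace ℂ (Fin k) →L[ℝ] EuclideanSpace ℂ (Fin k) :=
  Complex.I • .id ℝ _

theorem mulI_mulI (k : ℕ) (w : EuclideanSpace ℂ (Fin k)) : mulI k (mulI k w) = -w := by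
  simp [mulI, smul_smul]

theorem inner_mulI (k : ℕ) (v w : EuclideanSpace ℂ (Fin k)) :
    inner ℝ (mulI k v) (mulI k w) = inner ℝ v w := by
  simp only [mulI, PiLp.inner_apply, Complex.inner]
  refine Finset.sum_congr rfl fun i _ ↦ ?_
  simp

/-- The Riemannian product of the elliptic fibration of parameter `k` and the flat `ℂⁿ⁻²`. -/
def exampleManifold (n : ℕ) (hn : 2 ≤ n) (k : ℝ) : AlmostHermitianManifold.{u} (2 * n) :=
  GlobalChart.almostHermitian (productMetric_isMetricOn (splitting n hn) (isMetricOn k))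
    (productJ_isComplexOn (splitting n hn) (isComplexOn k) (mulI_mulI (n - 2)) (inner_mulI (n - 2)))

theorem exampleManifold_isAlmostKahler (n : ℕ) (hn : 2 ≤ n) (k : ℝ) :
    (exampleManifold.{u} n hn k).IsAlmostKahler := by
  refine (GlobalChart.isAlmostKahler_iff _ _).2 fun x u v w ↦ ?_
  rw [extDerivTwo_product _ (isMetricOn k) (isComplexOn k), extDerivTwo_fundamentalForm]

theorem exampleManifold_mem_akTwoClass (n : ℕ) (hn : 2 ≤ n) :
    exampleManifold.{u} n hn (-2) ∈ AKTwoClass (2 * n) :=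
  ⟨exampleManifold_isAlmostKahler n hn _, (GlobalChart.satisfiesGrayTwo_iff _ _).2 fun x ↦
    (grayTwo_product_iff _ (isMetricOn _) x).2 (grayTwo _)⟩

theorem exampleManifold_notMem_kahlerClass (n : ℕ) (hn : 2 ≤ n) :
    exampleManifold.{u} n hn (-2) ∉ KahlerClass (2 * n) := by
  intro h
  have := (grayOne_product_iff _ (isMetricOn _) 0).1
    (GlobalChart.grayOne_of_mem_kahlerClass _ _ h 0)
  rw [map_zero] at this
  exact not_grayOne this

theorem exampleManifold_mem_akThreeClass (n : ℕ) (hn : 2 ≤ n) :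
    exampleManifold.{u} n hn (-1) ∈ AKThreeClass (2 * n) :=
  ⟨exampleManifold_isAlmostKahler n hn _, (GlobalChart.satisfiesGrayThree_iff _ _).2 fun _ ↦
    grayThree_product _ (isMetricOn _) (grayThree _ _)⟩

theorem exampleManifold_notMem_akTwoClass (n : ℕ) (hn : 2 ≤ n) :
    exampleManifold.{u} n hn (-1) ∉ AKTwoClass (2 * n) := by
  intro h
  have := (grayTwo_product_iff _ (isMetricOn _) 0).1
    ((GlobalChart.satisfiesGrayTwo_iff _ _).1 h.2 0)
  rw [map_zero] at this
  exact not_grayTwo this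

end

theorem corollary2 (n : ℕ) (hn : 2 ≤ n) :
    KahlerClass.{u} (2 * n) ⊂ AKTwoClass.{u} (2 * n) ∧
      AKTwoClass.{u} (2 * n) ⊂ AKThreeClass.{u} (2 * n) :=
  ⟨(Set.ssubset_iff_of_subset (kahlerClass_subset_akTwoClass _)).2
      ⟨_, exampleManifold_mem_akTwoClass n hn, exampleManifold_notMem_kahlerClass n hn⟩,
    (Set.ssubset_iff_of_subset (akTwoClass_subset_akThreeClass _)).2
      ⟨_, exampleManifold_mem_akThreeClass n hn, exampleManifold_notMem_akTwoClass n hn⟩⟩
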